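/- Let $\mathcal X$ be a nonempty finite set, $k:\mathcal X\times\mathcal X\to\mathbb R$ a positive semidefinite kernel with $k(x,x)\le 1$ for all $x\in\mathcal X$, and $\sigma>0$. Let $f\sim\mathcal{GP}(0,k)$ be a centred Gaussian process on $\mathcal X$ with covariance $k$, let $\epsilon_1,\epsilon_2,\dots$ be i.i.d. $\mathcal N(0,\sigma^2)$, and let $\zeta_1,\zeta_2,\dots$ be i.i.d. with the shifted exponential law of $s+Z$, where $s=2\log(|\mathcal X|/2)$ and $Z\sim\mathrm{Exp}(1/2)$ (rate $1/2$); assume that $f$, $(\epsilon_t)_t$, $(\zeta_t)_t$ are mutually independent. Consider the algorithm IRGP-UCB: for $t=1,2,\dots$, given the data $\mathcal D_{t-1}=\{(x_i,y_i)\}_{i<t}$, it chooses $$x_t\in\operatorname*{arg\,max}_{x\in\mathcal X}\ \mu_{t-1}(x)+\zeta_t^{1/2}\sigma_{t-1}(x)$$ and observes $y_t=f(x_t)+\epsilon_t$, where $$\mu_{t-1}(x)=\mathbf k_{t-1}(x)^\top(\mathbf K+\sigma^2\mathbf I)^{-1}\mathbf y_{t-1},\qquad \sigma_{t-1}^2(x)=k(x,x)-\mathbf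 k_{t-1}(x)^\top(\mathbf K+\sigma^2\mathbf I)^{-1}\mathbf k_{t-1}(x),$$ with $\mathbf k_{t-1}(x)=(k(x,x_i))_{i<t}$, $\mathbf K=(k(x_i,x_j))_{i,j<t}$, $\mathbf y_{t-1}=(y_i)_{i<t}$. Ties in the arg max are broken measurably, in any way that depends only on $\mathcal D_{t-1}$, $\zeta_t$ and a random seed independent of $(f,(\epsilon_t)_t,(\zeta_t)_t)$; if $\zeta_t<0$ (possible only for $|\mathcal X|=1$), $\zeta_t^{1/2}$ is read as $0$. Let $x^*\in\operatorname{arg\,max}_{x\in\mathcal X}f(x)$, let $R_T=\sum_{t=1}^T\bigl(f(x^*)-f(x_t)\bigr)$ be the cumulative regret, and let $$\gamma_T=\max_{a_1,\dots,a_T\in\mathcal X} I\bigl((f(a_i)+\epsilon_i)_{i=1}^T;\,(f(a_i))_{i=1}^T\bigr)$$ be the maximum information gain, where $I$ is Shannon's mutual information with natural logarithm and the $a_i$ need not be distinct. Then for every fixed integer $T\ge 1$ and every $\delta\in(0,1)$, $$\Pr\left(R_T\le\frac{\sqrt{C_1C_2T\gamma_T}}{\delta}\right)\ge 1-\delta,\qquad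 C_1=\frac{2}{\log(1+\sigma^{-2})},\quad C_2=2+2\log\frac{|\mathcal X|}{2}.$$ -/

import Mathlib

open MeasureTheory ProbabilityTheory
open scoped ENNReal NNReal

noncomputable section

/-- The noise variance `σ²`, as a nonnegative real. -/
def noiseVar (σ : ℝ) : ℝ≥0 := ⟨σ ^ 2, sq_nonneg σ⟩

/-- `f` is a sample path of the Gaussian process `GP(0, k)`: all finite dimensional marginals are
Gaussian, the mean function is zero and the covariance function is `k`. -/
structure IsCenteredGP {Ω X : Type*} [MeasurableSpace Ω] (f : X → Ω → ℝ) (k : X → X → ℝ)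
    (P : Measure Ω) : Prop where
  isGaussianProcess : IsGaussianProcess f P
  mean_zero : ∀ x, ∫ ω, f x ω ∂P = 0
  covariance_eq : ∀ x x', covariance (f x) (f x') P = k x x'

/-- The shifted exponential distribution with shift `s` and rate `r`: the law of `s + Z`
with `Z ∼ Exp(r)`. -/
def shiftedExpMeasure (s r : ℝ) : Measure ℝ := (expMeasure r).map (fun z => s + z)

section Posterior

variable {X : Type*}

/-- The regularised kernel matrix `K + σ² I` of the queried points of a data set
`D = ((x₁, y₁), …, (xₙ, yₙ))`. -/
def regKernelMatrix (k : X → X → ℝ) (σ : ℝ) {n : ℕ} (D : Fin n → X × ℝ) :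
    Matrix (Fin n) (Fin n) ℝ :=
  Matrix.of (fun i j => k (D i).1 (D j).1) + σ ^ 2 • (1 : Matrix (Fin n) (Fin n) ℝ)

/-- The vector `(k(x, x₁), …, k(x, xₙ))`. -/
def kernelVec (k : X → X → ℝ) {n : ℕ} (D : Fin n → X × ℝ) (x : X) : Fin n → ℝ :=
  fun i => k x (D i).1

/-- The posterior mean of `f x` given the data `D`. -/
def postMean (k : X → X → ℝ) (σ : ℝ) {n : ℕ} (D : Fin n → X × ℝ) (x : X) : ℝ :=
  kernelVec k D x ⬝ᵥ Matrix.mulVec (regKernelMatrix k σ D)⁻¹ (fun i => (D i).2)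

/-- The posterior variance of `f x` given the data `D`. -/
def postVar (k : X → X → ℝ) (σ : ℝ) {n : ℕ} (D : Fin n → X × ℝ) (x : X) : ℝ :=
  k x x - kernelVec k D x ⬝ᵥ Matrix.mulVec (regKernelMatrix k σ D)⁻¹ (kernelVec k D x)

/-- The upper confidence bound `μ(x) + z^{1/2} σ(x)` with confidence parameter `z`. -/
def ucb (k : X → X → ℝ) (σ : ℝ) {n : ℕ} (D : Fin n → X × ℝ) (z : ℝ) (x : X) : ℝ :=
  postMean k σ D x + √z * √(postVar k σ D x)

/-- A rule for choosing the next query as a maximiser of the upper confidence bound: from the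
data `D` collected so far, the confidence parameter `z` of the current round and a random seed
`u` (used for breaking ties in any way), it returns a point of the domain, measurably. -/
structure IsUCBRule {S : Type*} [MeasurableSpace X] [MeasurableSpace S] (k : X → X → ℝ) (σ : ℝ)
    (pick : (n : ℕ) → (Fin n → X × ℝ) → ℝ → S → X) : Prop where
  measurable_pick : ∀ n,
    Measurable (fun p : (Fin n → X × ℝ) × ℝ × S => pick n p.1 p.2.1 p.2.2)
  le_ucb_pick : ∀ n (D : Fin n → X × ℝ) (z : ℝ) (u : S) (x : X),
    ucb k σ D z x ≤ ucb k σ D z (pick n D z u)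

end Posterior

/-- The Shannon mutual information (in nats) of two random variables: the Kullback-Leibler
divergence of their joint law from the product of their laws. -/
def mutualInfo {Ω α β : Type*} [MeasurableSpace Ω] [MeasurableSpace α] [MeasurableSpace β]
    (P : Measure Ω) (Y : Ω → α) (W : Ω → β) : ℝ≥0∞ :=
  InformationTheory.klDiv (P.map (fun ω => (Y ω, W ω))) ((P.map Y).prod (P.map W))

/-- The maximum information gain `γ_T` over a finite domain: the maximum over all `T`-tuples
`a₁, …, a_T` of points of the mutual information of `(f(aᵢ) + εᵢ)ᵢ` and `(f(aᵢ))ᵢ`, where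
`f ∼ N(0, k)` and the `εᵢ ∼ N(0, σ²)` are independent. -/
def maxInfoGain {X : Type*} [Fintype X] [DecidableEq X] (k : X → X → ℝ) (σ : ℝ) (T : ℕ) : ℝ :=
  (⨆ a : Fin T → X,
    mutualInfo
      ((multivariateGaussian (0 : EuclideanSpace ℝ X) (Matrix.of k)).prod
        (Measure.pi (fun _ : Fin T => gaussianReal 0 (noiseVar σ))))
      (fun p i => p.1 (a i) + p.2 i)
      (fun p i => p.1 (a i))).toReal

/-- The cumulative regret `R_T` at a realised objective `f` with maximiser `xstar` and queries
`x 0, …, x (T - 1)`. -/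
def cumRegret {X : Type*} (f : X → ℝ) (xstar : X) (x : ℕ → X) (T : ℕ) : ℝ :=
  ∑ t ∈ Finset.range T, (f xstar - f (x t))

end

/-! By Markov's inequality it suffices that the expected regret is at most `√(C₁ * C₂ * T *
maxInfoGain k σ T)`.

The heart is one round. Given the past, `f` is a posterior mean `m` plus a centred Gaussian residual
with variances `v`, and `E max (m + r) ≤ E max (m + √ζ √v)` (`integral_maxOver_le`). Indeed, a union
bound with the Gaussian tail `½ exp (-t² / 2v)` bounds the left tail at level `c` by `(N/2) exp
(-z₀/2)`, where `N` is the number of points and `z₀` is the least `(c - m x)² / v x` over the points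
with `v x > 0`. The shift `2 log (N/2)` and rate `1/2` are chosen so that this is exactly the
probability of `ζ > z₀`, and `ζ > z₀` lifts some upper confidence bound above `c`. The query attains
the largest bound, and the residual has mean zero at the query because it is independent of the
choice. So the expected regret of the round is at most `E (√ζ_t σ_{t-1}(x_t))`
(`integral_regret_le`).

Conditional expectations are avoided: the space is split over the finitely many query histories `a`.
For a frozen design `a` everything is jointly Gaussian, the residual is independent of the
observations, and the event that the history equals `a` depends only on those observations, the past
`ζ` and the seed.

Summing over rounds, Cauchy–Schwarz along each path separates `∑ ζ_t` from `∑ σ²_{t-1}(x_t)`. Jensen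
and `E ζ_t = C₂` control the first. The second is at most `C₁ γ_T` on every path
(`sum_queryVar_le`): the mutual information at a design is `½ ∑ log (1 + σ⁻² σ²_{t-1}(a_t))`
(`IsNoisyGP.mutualInfo_eq`), and the logarithm is concave. -/

/-! ### Tails and means of the Gaussian and shifted exponential laws. -/

theorem gaussianReal_Ioi_zero_le_half (v : ℝ≥0) : gaussianReal 0 v (Set.Ioi 0) ≤ 1 / 2 := by
  have h1 : gaussianReal 0 v (Set.Iio 0) = gaussianReal 0 v (Set.Ioi 0) := by
    conv_lhs => rw [← neg_zero, ← gaussianReal_map_neg]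
    rw [Measure.map_apply (by fun_prop) measurableSet_Iio]
    congr 1
    ext x
    simp
  have h2 : gaussianReal 0 v (Set.Ioi 0) + gaussianReal 0 v (Set.Ioi 0) ≤ 1 := by
    nth_rw 1 [← h1]
    rw [← measure_union (Set.disjoint_left.2 fun _ h h' =>
      lt_asymm (Set.mem_Iio.1 h) (Set.mem_Ioi.1 h'))
      measurableSet_Ioi]
    exact prob_le_one
  rw [ENNReal.le_div_iff_mul_le (by simp) (by simp), mul_two]
  exact h2

/-- Since `(x + t)² ≥ x² + t²` on the positive quadrant, the tail beyond `t` costs a factor `exp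
(-t² / 2v)` against the half-line, whose mass supplies the constant `1 / 2`. -/
theorem gaussianPDF_neg_le (v : ℝ≥0) {t x : ℝ} (ht : 0 ≤ t) (hx : 0 ≤ x) :
    gaussianPDF (-t) v x ≤ ENNReal.ofReal (Real.exp (-t ^ 2 / (2 * v))) * gaussianPDF 0 v x := by
  rw [gaussianPDF, gaussianPDF, ← ENNReal.ofReal_mul (Real.exp_pos _).le]
  apply ENNReal.ofReal_le_ofReal
  rw [gaussianPDFReal, gaussianPDFReal, mul_left_comm, ← Real.exp_add]
  gcongr
  rw [← add_div]
  gcongr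
  nlinarith [mul_nonneg ht hx]

/-- The Gaussian tail bound with the sharp constant `1 / 2`. -/
theorem gaussianReal_Ioi_le (v : ℝ≥0) {t : ℝ} (ht : 0 ≤ t) :
    gaussianReal 0 v (Set.Ioi t) ≤ ENNReal.ofReal (1 / 2 * Real.exp (-t ^ 2 / (2 * v))) := by
  -- For `v = 0` the division by zero makes the right-hand side `1 / 2`, while the Dirac mass at `0`
  -- gives `Ioi t` no mass.
  by_cases hv : v = 0
  · subst hv
    rw [gaussianReal_zero_var, Measure.dirac_apply' _ measurableSet_Ioi]
    simp [ht]
  have h1 : gaussianReal 0 v (Set.Ioi t) = gaussianReal (-t) v (Set.Ioi 0) := by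
    have := gaussianReal_map_sub_const (μ := 0) (v := v) t
    rw [zero_sub] at this
    rw [← this, Measure.map_apply (by fun_prop) measurableSet_Ioi]
    congr 1
    ext x
    simp
  rw [h1, gaussianReal_apply _ hv]
  calc ∫⁻ x in Set.Ioi 0, gaussianPDF (-t) v x
      ≤ ∫⁻ x in Set.Ioi 0, ENNReal.ofReal (Real.exp (-t ^ 2 / (2 * v))) * gaussianPDF 0 v x :=
        setLIntegral_mono' measurableSet_Ioi fun x hx => gaussianPDF_neg_le v ht (le_of_lt hx)
    _ = ENNReal.ofReal (Real.exp (-t ^ 2 / (2 * v))) * gaussianReal 0 v (Set.Ioi 0) := by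
        rw [lintegral_const_mul _ (measurable_gaussianPDF 0 v), gaussianReal_apply _ hv]
    _ ≤ ENNReal.ofReal (Real.exp (-t ^ 2 / (2 * v))) * (1 / 2) := by
        gcongr
        exact gaussianReal_Ioi_zero_le_half v
    _ = _ := by
        rw [mul_comm (1 / 2 : ℝ), ENNReal.ofReal_mul (Real.exp_pos _).le]
        congr 1
        rw [ENNReal.ofReal_div_of_pos (by norm_num)]
        simp

theorem expMeasure_Ioi {r z : ℝ} (hr : 0 < r) (hz : 0 ≤ z) :
    expMeasure r (Set.Ioi z) = ENNReal.ofReal (Real.exp (-(r * z))) := by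
  have := isProbabilityMeasure_expMeasure hr
  rw [← Set.compl_Iic, prob_compl_eq_one_sub measurableSet_Iic, ← ofReal_cdf,
    cdf_expMeasure_eq hr, if_pos hz, ← ENNReal.ofReal_one,
    ← ENNReal.ofReal_sub _ (by simp; positivity)]
  simp

theorem ae_nonneg_expMeasure {r : ℝ} (hr : 0 < r) : ∀ᵐ z ∂expMeasure r, 0 ≤ z := by
  have := isProbabilityMeasure_expMeasure hr
  have h : expMeasure r (Set.Ioi 0) = 1 := by simp [expMeasure_Ioi hr le_rfl]
  have h2 := (prob_compl_eq_zero_iff measurableSet_Ioi).2 h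
  rw [ae_iff]
  refine measure_mono_null (fun z hz => ?_) h2
  simp only [Set.mem_ofPred_eq, not_le] at hz
  simp [hz.le]

theorem lintegral_ofReal_expMeasure {r : ℝ} (hr : 0 < r) :
    ∫⁻ z, ENNReal.ofReal z ∂expMeasure r = ENNReal.ofReal (1 / r) := by
  rw [lintegral_eq_lintegral_meas_lt (f := fun z => z) _ (ae_nonneg_expMeasure hr) (by fun_prop)]
  have h1 : ∀ t ∈ Set.Ioi (0 : ℝ), expMeasure r {a | t < a}
      = ENNReal.ofReal (Real.exp (-r * t)) := fun t ht => by
    rw [neg_mul]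
    exact expMeasure_Ioi hr (le_of_lt ht)
  rw [setLIntegral_congr_fun measurableSet_Ioi h1,
    ← ofReal_integral_eq_lintegral_ofReal (exp_neg_integrableOn_Ioi 0 hr)
      (Filter.Eventually.of_forall fun _ => (Real.exp_pos _).le),
    integral_exp_mul_Ioi (by linarith) 0]
  simp [neg_div]

theorem integrable_id_expMeasure {r : ℝ} (hr : 0 < r) : Integrable (fun z => z) (expMeasure r) := by
  refine (lintegral_ofReal_ne_top_iff_integrable (by fun_prop) (ae_nonneg_expMeasure hr)).1 ?_
  rw [lintegral_ofReal_expMeasure hr]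
  simp

theorem integral_id_expMeasure {r : ℝ} (hr : 0 < r) : ∫ z, z ∂expMeasure r = 1 / r := by
  rw [integral_eq_lintegral_of_nonneg_ae (ae_nonneg_expMeasure hr) (by fun_prop),
    lintegral_ofReal_expMeasure hr, ENNReal.toReal_ofReal (by positivity)]

theorem isProbabilityMeasure_shiftedExpMeasure (s : ℝ) {r : ℝ} (hr : 0 < r) :
    IsProbabilityMeasure (shiftedExpMeasure s r) := by
  have := isProbabilityMeasure_expMeasure hr
  exact Measure.isProbabilityMeasure_map (by fun_prop)

theorem shiftedExpMeasure_Ioi {s r z : ℝ} (hr : 0 < r) (hz : s ≤ z) :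
    shiftedExpMeasure s r (Set.Ioi z) = ENNReal.ofReal (Real.exp (-(r * (z - s)))) := by
  rw [shiftedExpMeasure, Measure.map_apply (by fun_prop) measurableSet_Ioi,
    ← expMeasure_Ioi hr (sub_nonneg.2 hz)]
  congr 1
  ext x
  simp [sub_lt_iff_lt_add']

theorem ae_le_shiftedExpMeasure (s : ℝ) {r : ℝ} (hr : 0 < r) :
    ∀ᵐ z ∂shiftedExpMeasure s r, s ≤ z := by
  rw [shiftedExpMeasure, ae_map_iff (by fun_prop) measurableSet_Ici]
  filter_upwards [ae_nonneg_expMeasure hr] with z hz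
  linarith

theorem integrable_id_shiftedExpMeasure (s : ℝ) {r : ℝ} (hr : 0 < r) :
    Integrable (fun z => z) (shiftedExpMeasure s r) := by
  have := isProbabilityMeasure_expMeasure hr
  rw [shiftedExpMeasure, integrable_map_measure (by fun_prop) (by fun_prop)]
  exact (integrable_const s).add (integrable_id_expMeasure hr)

theorem integral_id_shiftedExpMeasure (s : ℝ) {r : ℝ} (hr : 0 < r) :
    ∫ z, z ∂shiftedExpMeasure s r = s + 1 / r := by
  have := isProbabilityMeasure_expMeasure hr
  rw [shiftedExpMeasure, integral_map (by fun_prop) (by fun_prop),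
    integral_add (integrable_const s) (integrable_id_expMeasure hr), integral_id_expMeasure hr]
  simp

/-- If `A` is independent of `B` and `(A, B)` is independent of `C`, then `A` is independent
of `(B, C)`. -/
theorem indepFun_prodMk_of_indepFun {Ω α β γ : Type*} [MeasurableSpace Ω] [MeasurableSpace α]
    [MeasurableSpace β] [MeasurableSpace γ] {P : Measure Ω} [IsProbabilityMeasure P]
    {A : Ω → α} {B : Ω → β} {C : Ω → γ} (hA : Measurable A) (hB : Measurable B)
    (hC : Measurable C) (hAB : IndepFun A B P) (hABC : IndepFun (fun ω => (A ω, B ω)) C P) :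
    IndepFun A (fun ω => (B ω, C ω)) P := by
  have hBC : IndepFun B C P := hABC.comp measurable_snd measurable_id
  rw [indepFun_iff_map_prod_eq_prod_map_map (by fun_prop) (by fun_prop)] at hAB hABC hBC ⊢
  have := Measure.isProbabilityMeasure_map (μ := P) hA.aemeasurable
  have := Measure.isProbabilityMeasure_map (μ := P) hB.aemeasurable
  have := Measure.isProbabilityMeasure_map (μ := P) hC.aemeasurable
  rw [hBC, ← Measure.prodAssoc_prod, ← hAB, ← hABC, Measure.map_map (by fun_prop) (by fun_prop)]
  rfl

/-! ### Domination of a Gaussian maximum by the randomised confidence bound. -/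

section Domination

variable {X : Type*} [Fintype X] [Nonempty X]

/-- The maximum of a real function on a nonempty finite type. -/
noncomputable def maxOver (g : X → ℝ) : ℝ := Finset.univ.sup' Finset.univ_nonempty g

theorem lt_maxOver_iff {g : X → ℝ} {c : ℝ} : c < maxOver g ↔ ∃ x, c < g x := by
  simp [maxOver, Finset.lt_sup'_iff]

theorem maxOver_le_iff {g : X → ℝ} {c : ℝ} : maxOver g ≤ c ↔ ∀ x, g x ≤ c := by
  simp [maxOver]

theorem le_maxOver (g : X → ℝ) (x : X) : g x ≤ maxOver g :=
  Finset.le_sup' g (Finset.mem_univ x)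

theorem maxOver_eq {g : X → ℝ} {x : X} (h : ∀ z, g z ≤ g x) : maxOver g = g x :=
  le_antisymm (maxOver_le_iff.2 h) (le_maxOver g x)

theorem maxOver_mono {g h : X → ℝ} (H : ∀ x, g x ≤ h x) : maxOver g ≤ maxOver h :=
  maxOver_le_iff.2 fun x => (H x).trans (le_maxOver h x)

theorem abs_maxOver_le (g : X → ℝ) : |maxOver g| ≤ ∑ x, |g x| := by
  obtain ⟨x, -, hx⟩ := Finset.exists_mem_eq_sup' Finset.univ_nonempty g
  rw [maxOver, hx]
  exact Finset.single_le_sum (f := fun x => |g x|) (fun _ _ => abs_nonneg _) (Finset.mem_univ x)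

theorem measurable_maxOver : Measurable (maxOver : (X → ℝ) → ℝ) := by
  have := Finset.measurable_sup' (s := (Finset.univ : Finset X)) Finset.univ_nonempty
    (f := fun x (g : X → ℝ) => g x) (fun x _ => measurable_pi_apply x)
  convert this using 1
  ext g
  simp [maxOver, Finset.sup'_apply]

theorem Integrable.maxOver_comp {Ω : Type*} [MeasurableSpace Ω] {P : Measure Ω} {g : X → Ω → ℝ}
    (hg : ∀ x, Integrable (g x) P) : Integrable (fun ω => maxOver fun x => g x ω) P := by
  refine (integrable_finsetSum Finset.univ fun x _ => (hg x).abs).mono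
    ((measurable_maxOver.comp_aemeasurable
      (aemeasurable_pi_lambda _ fun x => (hg x).aestronglyMeasurable.aemeasurable)).aestronglyMeasurable)
    (Filter.Eventually.of_forall fun ω => ?_)
  rw [Real.norm_eq_abs, Real.norm_eq_abs]
  exact (abs_maxOver_le _).trans (le_abs_self _)

/-- The tail of the maximum of a Gaussian vector is dominated by the tail of the maximum of the
randomised upper confidence bounds. -/
theorem measure_lt_maxOver_le (hX : 2 ≤ Fintype.card X) {ν : Measure (X → ℝ)} {v : X → ℝ≥0}
    (hν : ∀ x, HasLaw (fun r : X → ℝ => r x) (gaussianReal 0 (v x)) ν) (m : X → ℝ)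
    {c : ℝ} (hc : maxOver (fun x => m x + √(2 * Real.log ((Fintype.card X : ℝ) / 2)) * √(v x)) ≤ c) :
    ν {r | c < maxOver (fun x => m x + r x)}
      ≤ shiftedExpMeasure (2 * Real.log ((Fintype.card X : ℝ) / 2)) (1 / 2)
        {z | c < maxOver (fun x => m x + √z * √(v x))} := by
  set N : ℝ := (Fintype.card X : ℝ) with hN
  have hN2 : (2 : ℝ) ≤ N := by rw [hN]; exact_mod_cast hX
  set s := 2 * Real.log (N / 2) with hs
  have hs0 : 0 ≤ s := mul_nonneg zero_le_two (Real.log_nonneg (by linarith))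
  rw [maxOver_le_iff] at hc
  have hcm : ∀ x, 0 ≤ c - m x := fun x => by
    have : 0 ≤ √s * √(v x : ℝ) := by positivity
    linarith [hc x]
  have hsub : {r : X → ℝ | c < maxOver (fun x => m x + r x)}
      ⊆ ⋃ x ∈ (Finset.univ : Finset X), {r | c - m x < r x} := by
    intro r hr
    obtain ⟨x, hx⟩ := lt_maxOver_iff.1 hr
    simp only [Finset.mem_univ, Set.iUnion_true, Set.mem_iUnion, Set.mem_ofPred_eq]
    exact ⟨x, by linarith⟩
  have htail : ∀ x, ν {r | c - m x < r x} = gaussianReal 0 (v x) (Set.Ioi (c - m x)) :=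
    fun x => (hν x).measure_eq (p := fun y => c - m x < y) measurableSet_Ioi
  have hle : ν {r : X → ℝ | c < maxOver (fun x => m x + r x)}
      ≤ ∑ x, gaussianReal 0 (v x) (Set.Ioi (c - m x)) := by
    refine (measure_mono hsub).trans ((measure_biUnion_finset_le _ _).trans_eq ?_)
    exact Finset.sum_congr rfl fun x _ => htail x
  refine hle.trans ?_
  -- Degenerate coordinates never exceed `c`, so they drop out of the union bound and `z₀` may be
  -- minimised over positive variances only.
  have hzero : ∀ x, v x = 0 → gaussianReal 0 (v x) (Set.Ioi (c - m x)) = 0 := fun x hx => by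
    rw [hx, gaussianReal_zero_var, Measure.dirac_apply' _ measurableSet_Ioi]
    simpa using hcm x
  by_cases hne : (Finset.univ.filter fun x => v x ≠ 0).Nonempty
  swap
  · rw [Finset.sum_eq_zero fun x _ => hzero x ?_]
    · exact bot_le
    · by_contra hx
      exact hne ⟨x, by simp [hx]⟩
  -- `x₀` is the coordinate with the heaviest tail bound, and `z₀` is the confidence parameter at
  -- which its upper confidence bound reaches `c`.
  obtain ⟨x₀, hx₀, hmin⟩ := Finset.exists_min_image _ (fun x => (c - m x) ^ 2 / (v x : ℝ)) hne
  simp only [ne_eq, Finset.mem_filter, Finset.mem_univ, true_and] at hx₀ hmin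
  set z₀ := (c - m x₀) ^ 2 / (v x₀ : ℝ) with hz₀
  have hv₀ : 0 < (v x₀ : ℝ) := NNReal.coe_pos.2 (pos_iff_ne_zero.2 hx₀)
  have hz₀0 : 0 ≤ z₀ := by positivity
  -- The assumption on `c` places `z₀` beyond the shift, where the tail of the shifted exponential
  -- law is a pure exponential.
  have hsz : s ≤ z₀ := by
    rw [hz₀, le_div_iff₀ hv₀]
    have h1 : √s * √(v x₀ : ℝ) ≤ c - m x₀ := by linarith [hc x₀]
    calc s * v x₀ = (√s * √(v x₀ : ℝ)) ^ 2 := by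
          rw [mul_pow, Real.sq_sqrt hs0, Real.sq_sqrt hv₀.le]
      _ ≤ _ := by gcongr
  calc ∑ x, gaussianReal 0 (v x) (Set.Ioi (c - m x))
      ≤ ∑ _x : X, ENNReal.ofReal (1 / 2 * Real.exp (-z₀ / 2)) := by
        refine Finset.sum_le_sum fun x _ => ?_
        by_cases hx : v x = 0
        · rw [hzero x hx]; exact bot_le
        · refine (gaussianReal_Ioi_le _ (hcm x)).trans (ENNReal.ofReal_le_ofReal ?_)
          have hvx : 0 < (v x : ℝ) := NNReal.coe_pos.2 (pos_iff_ne_zero.2 hx)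
          have h1 : -(c - m x) ^ 2 / (2 * (v x : ℝ)) = -((c - m x) ^ 2 / v x) / 2 := by
            field_simp
          rw [h1]
          gcongr
          exact hmin x hx
    -- Calibration of shift and rate: `exp (-(z₀ - s) / 2) = (N / 2) exp (-z₀ / 2)`, which is `N`
    -- times the common tail bound.
    _ = shiftedExpMeasure s (1 / 2) (Set.Ioi z₀) := by
        rw [shiftedExpMeasure_Ioi (by norm_num) hsz, Finset.sum_const, Finset.card_univ,
          nsmul_eq_mul, ← ENNReal.ofReal_natCast, ← ENNReal.ofReal_mul (by positivity), ← hN]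
        congr 1
        have : -(1 / 2 * (z₀ - s)) = -z₀ / 2 + Real.log (N / 2) := by rw [hs]; ring
        rw [this, Real.exp_add, Real.exp_log (by linarith)]
        ring
    _ ≤ _ := by
        refine measure_mono fun z hz => ?_
        refine lt_maxOver_iff.2 ⟨x₀, ?_⟩
        have hz' : z₀ < z := hz
        have : c - m x₀ < √z * √(v x₀ : ℝ) := by
          rw [← Real.sqrt_mul (hz₀0.trans hz'.le), Real.lt_sqrt (hcm x₀)]
          rwa [hz₀, div_lt_iff₀ hv₀] at hz'
        linarith

/-- The expected maximum of a Gaussian vector is at most the expected maximum of the randomised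
upper confidence bounds of its entries. -/
theorem integral_maxOver_le (hX : 2 ≤ Fintype.card X) {ν : Measure (X → ℝ)}
    [IsProbabilityMeasure ν] {v : X → ℝ≥0}
    (hν : ∀ x, HasLaw (fun r : X → ℝ => r x) (gaussianReal 0 (v x)) ν) (m : X → ℝ) :
    ∫ r, maxOver (fun x => m x + r x) ∂ν
      ≤ ∫ z, maxOver (fun x => m x + √z * √(v x))
        ∂shiftedExpMeasure (2 * Real.log ((Fintype.card X : ℝ) / 2)) (1 / 2) := by
  set s := 2 * Real.log ((Fintype.card X : ℝ) / 2) with hs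
  set τ := shiftedExpMeasure s (1 / 2) with hτ
  have : IsProbabilityMeasure τ := isProbabilityMeasure_shiftedExpMeasure s (by norm_num)
  -- Tails are compared only above `b`. Nothing is lost below it: the maximal confidence bound is
  -- almost surely at least `b`, and on the Gaussian side the positive part of the excess over `b`
  -- dominates the excess.
  set b := maxOver (fun x => m x + √s * √(v x)) with hb
  have hIr : Integrable (fun r : X → ℝ => maxOver (fun x => m x + r x)) ν := by
    refine Integrable.maxOver_comp (g := fun x (r : X → ℝ) => m x + r x) fun x => (integrable_const _).add ?_
    have h1 : Integrable (fun y : ℝ => y) (gaussianReal 0 (v x)) :=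
      (memLp_id_gaussianReal 1).integrable le_rfl
    rw [← (hν x).map_eq] at h1
    exact h1.comp_aemeasurable (hν x).aemeasurable
  have hIsq : Integrable (fun z => √z) τ := by
    refine ((integrable_const 1).add (integrable_id_shiftedExpMeasure s (r := 1 / 2)
      (by norm_num)).abs).mono (by fun_prop) (Filter.Eventually.of_forall fun z => ?_)
    rw [Real.norm_of_nonneg (Real.sqrt_nonneg _)]
    refine le_trans ?_ (le_abs_self _)
    rw [Pi.add_apply, Real.sqrt_le_left (by positivity)]
    nlinarith [le_abs_self z, abs_nonneg z]
  have hIz : Integrable (fun z => maxOver (fun x => m x + √z * √(v x))) τ :=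
    Integrable.maxOver_comp (g := fun x z => m x + √z * √(v x)) fun x =>
      (integrable_const _).add (hIsq.mul_const _)
  have hmz : Measurable (fun z => maxOver (fun x => m x + √z * √(v x))) :=
    measurable_maxOver.comp (measurable_pi_lambda _ fun x => by fun_prop)
  have hmr : Measurable (fun r : X → ℝ => maxOver (fun x => m x + r x)) :=
    measurable_maxOver.comp (measurable_pi_lambda _ fun x => by fun_prop)
  have hbz : ∀ᵐ z ∂τ, b ≤ maxOver (fun x => m x + √z * √(v x)) := by
    filter_upwards [ae_le_shiftedExpMeasure s (r := 1 / 2) (by norm_num)] with z hz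
    exact maxOver_mono fun x => by gcongr
  have hr0 : 0 ≤ᵐ[ν] fun r : X → ℝ => max (maxOver (fun x => m x + r x) - b) 0 :=
    Filter.Eventually.of_forall fun _ => le_max_right _ _
  have hkey : ∫⁻ r, ENNReal.ofReal (max (maxOver (fun x => m x + r x) - b) 0) ∂ν
      ≤ ∫⁻ z, ENNReal.ofReal (maxOver (fun x => m x + √z * √(v x)) - b) ∂τ := by
    rw [lintegral_eq_lintegral_meas_lt _ hr0
      ((hmr.sub_const b).max measurable_const).aemeasurable,
      lintegral_eq_lintegral_meas_lt _ (hbz.mono fun z hz => sub_nonneg.2 hz)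
      (hmz.sub_const b).aemeasurable]
    refine setLIntegral_mono' measurableSet_Ioi fun t (ht : 0 < t) => ?_
    have h1 : {r : X → ℝ | t < max (maxOver (fun x => m x + r x) - b) 0}
        = {r | b + t < maxOver (fun x => m x + r x)} := by
      ext r
      simp only [Set.mem_ofPred_eq, lt_max_iff, not_lt.2 ht.le, or_false]
      exact lt_sub_iff_add_lt'
    have h2 : {z : ℝ | t < maxOver (fun x => m x + √z * √(v x)) - b}
        = {z | b + t < maxOver (fun x => m x + √z * √(v x))} := by
      ext r
      simp only [Set.mem_ofPred_eq, lt_sub_iff_add_lt']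
    rw [h1, h2]
    exact measure_lt_maxOver_le hX hν m (by linarith)
  have hIr' : Integrable (fun r => max (maxOver (fun x => m x + r x) - b) 0) ν :=
    (hIr.sub (integrable_const b)).pos_part
  have h3 : ∫ r, max (maxOver (fun x => m x + r x) - b) 0 ∂ν
      ≤ ∫ z, (maxOver (fun x => m x + √z * √(v x)) - b) ∂τ := by
    rw [integral_eq_lintegral_of_nonneg_ae hr0
      hIr'.aestronglyMeasurable, integral_eq_lintegral_of_nonneg_ae
      (hbz.mono fun z hz => sub_nonneg.2 hz) (hIz.sub (integrable_const b)).aestronglyMeasurable]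
    refine ENNReal.toReal_mono ?_ hkey
    exact (lintegral_ofReal_ne_top_iff_integrable (hIz.sub (integrable_const b)).aestronglyMeasurable
      (hbz.mono fun z hz => sub_nonneg.2 hz)).2 (hIz.sub (integrable_const b))
  have h4 : ∫ r, (maxOver (fun x => m x + r x) - b) ∂ν
      ≤ ∫ r, max (maxOver (fun x => m x + r x) - b) 0 ∂ν :=
    integral_mono (hIr.sub (integrable_const b)) hIr' fun _ => le_max_left _ _
  rw [integral_sub hIr (integrable_const b)] at h4
  rw [integral_sub hIz (integrable_const b)] at h3
  simp only [integral_const, probReal_univ, one_smul] at h3 h4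
  linarith

end Domination

/-! ### Gaussian regression at a fixed design: residuals and observations. -/

/-- A centred Gaussian process `f` with covariance function `k`, together with a family `ε` of
centred Gaussian noise variables of variance `σ²`, all uncorrelated and jointly Gaussian. -/
structure IsNoisyGP {Ω X ι : Type*} [MeasurableSpace Ω] [DecidableEq ι] (f : X → Ω → ℝ)
    (ε : ι → Ω → ℝ) (k : X → X → ℝ) (σ : ℝ) (P : Measure Ω) : Prop where
  gaussian : IsGaussianProcess (Sum.elim f ε) P
  measurable_f : ∀ x, Measurable (f x)
  measurable_noise : ∀ i, Measurable (ε i)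
  mean_f : ∀ x, ∫ ω, f x ω ∂P = 0
  mean_noise : ∀ i, ∫ ω, ε i ω ∂P = 0
  cov_f : ∀ x x', cov[f x, f x'; P] = k x x'
  cov_f_noise : ∀ x i, cov[f x, ε i; P] = 0
  cov_noise : ∀ i j, cov[ε i, ε j; P] = if i = j then σ ^ 2 else 0

/-- The coefficients of the posterior mean of `f x` given observations at `a`. -/
noncomputable def postWeights {X : Type*} (k : X → X → ℝ) (σ : ℝ) {n : ℕ} (a : Fin n → X) (x : X) :
    Fin n → ℝ :=
  Matrix.mulVec (regKernelMatrix k σ (fun i => (a i, (0 : ℝ))))⁻¹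
    (kernelVec k (fun i => (a i, (0 : ℝ))) x)

/-- The posterior variance at `x` after querying the points `a`. -/
noncomputable def queryVar {X : Type*} (k : X → X → ℝ) (σ : ℝ) {n : ℕ} (a : Fin n → X) (x : X) : ℝ :=
  postVar k σ (fun i => (a i, (0 : ℝ))) x

section Kernel

variable {X : Type*} {k : X → X → ℝ} {σ : ℝ} {n : ℕ}

theorem kernel_symm (hk : (Matrix.of k).PosSemidef) (x x' : X) : k x x' = k x' x := by
  simpa using (hk.isHermitian.apply x' x)

theorem regKernelMatrix_apply (D : Fin n → X × ℝ) (i j : Fin n) :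
    regKernelMatrix k σ D i j = k (D i).1 (D j).1 + if i = j then σ ^ 2 else 0 := by
  simp [regKernelMatrix, Matrix.one_apply]

theorem posDef_regKernelMatrix (hk : (Matrix.of k).PosSemidef) (hσ : 0 < σ) (D : Fin n → X × ℝ) :
    (regKernelMatrix k σ D).PosDef := by
  have h1 : (Matrix.of fun i j => k (D i).1 (D j).1).PosSemidef :=
    hk.submatrix fun i => (D i).1
  exact Matrix.PosDef.posSemidef_add h1 (Matrix.PosDef.one.smul (by positivity))

theorem regKernelMatrix_transpose (hk : (Matrix.of k).PosSemidef) (D : Fin n → X × ℝ) :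
    (regKernelMatrix k σ D).transpose = regKernelMatrix k σ D := by
  ext i j
  rw [Matrix.transpose_apply, regKernelMatrix_apply, regKernelMatrix_apply, kernel_symm hk]
  simp [eq_comm]

/-- The normal equations of the best linear predictor; they make the residual orthogonal to the
observations. -/
theorem sum_regKernelMatrix_mul_postWeights (hk : (Matrix.of k).PosSemidef) (hσ : 0 < σ)
    (a : Fin n → X) (x : X) (j : Fin n) :
    ∑ i, (k (a j) (a i) + if j = i then σ ^ 2 else 0) * postWeights k σ a x i = k x (a j) := by
  have h := (posDef_regKernelMatrix hk hσ (fun i => (a i, (0 : ℝ)))).isUnit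
  have h2 : Matrix.mulVec (regKernelMatrix k σ (fun i => (a i, (0 : ℝ)))) (postWeights k σ a x)
      = kernelVec k (fun i => (a i, (0 : ℝ))) x := by
    rw [postWeights, Matrix.mulVec_mulVec, Matrix.mul_nonsing_inv _
      ((Matrix.isUnit_iff_isUnit_det _).1 h), Matrix.one_mulVec]
  have h3 := congrFun h2 j
  simpa only [Matrix.mulVec, dotProduct, regKernelMatrix_apply, kernelVec] using h3

theorem postMean_eq_sum (hk : (Matrix.of k).PosSemidef) (D : Fin n → X × ℝ) (x : X) :
    postMean k σ D x = ∑ i, postWeights k σ (fun i => (D i).1) x i * (D i).2 := by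
  have : (regKernelMatrix k σ D)⁻¹.transpose = (regKernelMatrix k σ D)⁻¹ := by
    rw [Matrix.transpose_nonsing_inv, regKernelMatrix_transpose hk]
  rw [postMean, Matrix.dotProduct_mulVec, ← Matrix.mulVec_transpose, this]
  -- Definitional, because the matrix and the kernel vector read only the inputs; the dummy
  -- observations `0` in `postWeights` are never used.
  rfl

theorem queryVar_eq (a : Fin n → X) (x : X) :
    queryVar k σ a x = k x x - ∑ i, k x (a i) * postWeights k σ a x i := rfl

theorem queryVar_le (hk : (Matrix.of k).PosSemidef) (hσ : 0 < σ) (a : Fin n → X) (x : X) :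
    queryVar k σ a x ≤ k x x := by
  have h := (posDef_regKernelMatrix hk hσ (fun i => (a i, (0 : ℝ)))).inv.posSemidef.dotProduct_mulVec_nonneg
    (kernelVec k (fun i => (a i, (0 : ℝ))) x)
  rw [star_trivial] at h
  exact sub_le_self _ h

end Kernel

namespace IsNoisyGP

variable {Ω X ι : Type*} [MeasurableSpace Ω] [DecidableEq ι] {f : X → Ω → ℝ}
  {ε : ι → Ω → ℝ} {k : X → X → ℝ} {σ : ℝ} {P : Measure Ω} {n : ℕ}

theorem isProbabilityMeasure (h : IsNoisyGP f ε k σ P) : IsProbabilityMeasure P :=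
  h.gaussian.isProbabilityMeasure

theorem memLp_f (h : IsNoisyGP f ε k σ P) (x : X) : MemLp (f x) 2 P :=
  (h.gaussian.hasGaussianLaw_eval (Sum.inl x)).memLp_two

theorem memLp_noise (h : IsNoisyGP f ε k σ P) (i : ι) : MemLp (ε i) 2 P :=
  (h.gaussian.hasGaussianLaw_eval (Sum.inr i)).memLp_two

theorem integrable_f (h : IsNoisyGP f ε k σ P) (x : X) : Integrable (f x) P :=
  (h.gaussian.hasGaussianLaw_eval (Sum.inl x)).integrable

theorem integrable_noise (h : IsNoisyGP f ε k σ P) (i : ι) : Integrable (ε i) P :=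
  (h.gaussian.hasGaussianLaw_eval (Sum.inr i)).integrable

end IsNoisyGP

/-- The noisy observations at the points `a`, with noise variables selected by `e`. -/
def noisyObs {Ω X ι : Type*} (f : X → Ω → ℝ) (ε : ι → Ω → ℝ) {n : ℕ} (a : Fin n → X)
    (e : Fin n → ι) (i : Fin n) (ω : Ω) : ℝ := f (a i) ω + ε (e i) ω

/-- The difference of `f x` and its posterior mean given noisy observations at the points `a`. -/
noncomputable def postResidual {Ω X ι : Type*} (f : X → Ω → ℝ) (ε : ι → Ω → ℝ) (k : X → X → ℝ) (σ : ℝ)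
    {n : ℕ} (a : Fin n → X) (e : Fin n → ι) (x : X) (ω : Ω) : ℝ :=
  f x ω - ∑ i, postWeights k σ a x i * noisyObs f ε a e i ω

namespace IsNoisyGP

variable {Ω X ι : Type*} [MeasurableSpace Ω] [DecidableEq ι] {f : X → Ω → ℝ}
  {ε : ι → Ω → ℝ} {k : X → X → ℝ} {σ : ℝ} {P : Measure Ω} {n : ℕ}

theorem measurable_noisyObs (h : IsNoisyGP f ε k σ P) (a : Fin n → X) (e : Fin n → ι) (i : Fin n) :
    Measurable (noisyObs f ε a e i) :=
  (h.measurable_f _).add (h.measurable_noise _)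

theorem measurable_residual (h : IsNoisyGP f ε k σ P) (a : Fin n → X) (e : Fin n → ι) (x : X) :
    Measurable (postResidual f ε k σ a e x) :=
  (h.measurable_f x).sub (Finset.measurable_fun_sum _ fun i _ =>
    (h.measurable_noisyObs a e i).const_mul _)

theorem memLp_noisyObs (h : IsNoisyGP f ε k σ P) (a : Fin n → X) (e : Fin n → ι) (i : Fin n) :
    MemLp (noisyObs f ε a e i) 2 P :=
  (h.memLp_f _).add (h.memLp_noise _)

theorem memLp_sum_noisyObs (h : IsNoisyGP f ε k σ P) (a : Fin n → X) (e : Fin n → ι)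
    (w : Fin n → ℝ) : MemLp (fun ω => ∑ i, w i * noisyObs f ε a e i ω) 2 P :=
  memLp_finsetSum _ fun i _ => (h.memLp_noisyObs a e i).const_mul _

theorem memLp_residual (h : IsNoisyGP f ε k σ P) (a : Fin n → X) (e : Fin n → ι) (x : X) :
    MemLp (postResidual f ε k σ a e x) 2 P :=
  (h.memLp_f x).sub (h.memLp_sum_noisyObs a e _)

theorem cov_f_noisyObs (h : IsNoisyGP f ε k σ P) (a : Fin n → X) (e : Fin n → ι) (x : X)
    (i : Fin n) : cov[f x, noisyObs f ε a e i; P] = k x (a i) := by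
  have := h.isProbabilityMeasure
  have h1 := covariance_add_right (h.memLp_f x) (h.memLp_f (a i)) (h.memLp_noise (e i))
  rw [h.cov_f, h.cov_f_noise, add_zero] at h1
  exact h1

theorem cov_noise_noisyObs (h : IsNoisyGP f ε k σ P) (a : Fin n → X) (e : Fin n → ι) (j : ι)
    (i : Fin n) : cov[ε j, noisyObs f ε a e i; P] = if j = e i then σ ^ 2 else 0 := by
  have := h.isProbabilityMeasure
  have h1 := covariance_add_right (h.memLp_noise j) (h.memLp_f (a i)) (h.memLp_noise (e i))
  rw [covariance_comm (ε j) (f (a i)), h.cov_f_noise, zero_add, h.cov_noise] at h1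
  exact h1

/-- Injectivity of `e` gives distinct observations distinct noises even when `a` repeats a point. A
general `e` allows the noises of a prefix to be taken from a longer family. -/
theorem cov_noisyObs (h : IsNoisyGP f ε k σ P) (a : Fin n → X) {e : Fin n → ι}
    (he : Function.Injective e) (i j : Fin n) :
    cov[noisyObs f ε a e i, noisyObs f ε a e j; P]
      = k (a i) (a j) + if i = j then σ ^ 2 else 0 := by
  have := h.isProbabilityMeasure
  have h1 := covariance_add_left (h.memLp_f (a i)) (h.memLp_noise (e i)) (h.memLp_noisyObs a e j)
  rw [h.cov_f_noisyObs, h.cov_noise_noisyObs] at h1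
  simp only [he.eq_iff] at h1
  exact h1

theorem cov_sum_noisyObs (h : IsNoisyGP f ε k σ P) (a : Fin n → X) {e : Fin n → ι}
    {Z : Ω → ℝ} (hZ : MemLp Z 2 P) (w : Fin n → ℝ) :
    cov[Z, fun ω => ∑ i, w i * noisyObs f ε a e i ω; P]
      = ∑ i, cov[Z, noisyObs f ε a e i; P] * w i := by
  have := h.isProbabilityMeasure
  rw [covariance_fun_sum_right (fun i => (h.memLp_noisyObs a e i).const_mul _) hZ]
  exact Finset.sum_congr rfl fun i _ => by rw [covariance_const_mul_right, mul_comm]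

theorem cov_residual_noisyObs (h : IsNoisyGP f ε k σ P) (hk : (Matrix.of k).PosSemidef)
    (hσ : 0 < σ) (a : Fin n → X) {e : Fin n → ι} (he : Function.Injective e) (x : X) (j : Fin n) :
    cov[postResidual f ε k σ a e x, noisyObs f ε a e j; P] = 0 := by
  have := h.isProbabilityMeasure
  have h1 := covariance_fun_sub_left (h.memLp_f x) (h.memLp_sum_noisyObs a e (postWeights k σ a x))
    (h.memLp_noisyObs a e j)
  rw [h.cov_f_noisyObs, covariance_comm (fun ω => ∑ i, _),
    h.cov_sum_noisyObs a (h.memLp_noisyObs a e j)] at h1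
  simp only [h.cov_noisyObs a he] at h1
  rw [sum_regKernelMatrix_mul_postWeights hk hσ, sub_self] at h1
  exact h1

/-- By orthogonality to the observations, the variance of the residual is its covariance with `f x`
alone. -/
theorem variance_residual (h : IsNoisyGP f ε k σ P) (hk : (Matrix.of k).PosSemidef)
    (hσ : 0 < σ) (a : Fin n → X) {e : Fin n → ι} (he : Function.Injective e) (x : X) :
    Var[postResidual f ε k σ a e x; P] = queryVar k σ a x := by
  have := h.isProbabilityMeasure
  rw [← covariance_self (h.measurable_residual a e x).aemeasurable]
  have h1 := covariance_fun_sub_right (h.memLp_residual a e x) (h.memLp_f x)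
    (h.memLp_sum_noisyObs a e (postWeights k σ a x))
  have h2 := covariance_fun_sub_left (h.memLp_f x) (h.memLp_sum_noisyObs a e (postWeights k σ a x))
    (h.memLp_f x)
  rw [h.cov_f, covariance_comm (fun ω => ∑ i, _), h.cov_sum_noisyObs a (h.memLp_f x)] at h2
  rw [h.cov_sum_noisyObs a (h.memLp_residual a e x)] at h1
  simp only [h.cov_residual_noisyObs hk hσ a he, zero_mul, Finset.sum_const_zero, sub_zero] at h1
  simp only [h.cov_f_noisyObs] at h2
  rw [queryVar_eq, ← h2]
  exact h1

theorem integral_noisyObs (h : IsNoisyGP f ε k σ P) (a : Fin n → X) (e : Fin n → ι) (i : Fin n) :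
    ∫ ω, noisyObs f ε a e i ω ∂P = 0 := by
  simp only [noisyObs]
  rw [integral_add (h.integrable_f _) (h.integrable_noise _), h.mean_f, h.mean_noise, add_zero]

theorem integral_residual (h : IsNoisyGP f ε k σ P) (a : Fin n → X) (e : Fin n → ι) (x : X) :
    ∫ ω, postResidual f ε k σ a e x ω ∂P = 0 := by
  have := h.isProbabilityMeasure
  simp only [postResidual]
  rw [integral_sub (h.integrable_f _) ((h.memLp_sum_noisyObs a e _).integrable (by norm_num)),
    h.mean_f, integral_finsetSum _ fun i _ =>
      ((h.memLp_noisyObs a e i).const_mul _).integrable (by norm_num)]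
  simp [integral_const_mul, h.integral_noisyObs]

theorem queryVar_nonneg (h : IsNoisyGP f ε k σ P) (hk : (Matrix.of k).PosSemidef)
    (hσ : 0 < σ) (a : Fin n → X) {e : Fin n → ι} (he : Function.Injective e) (x : X) :
    0 ≤ queryVar k σ a x := by
  rw [← h.variance_residual hk hσ a he]
  exact variance_nonneg _ _

/-- The residuals and the observations are jointly Gaussian. -/
theorem isGaussianProcess_residual_noisyObs (h : IsNoisyGP f ε k σ P) (a : Fin n → X)
    (e : Fin n → ι) :
    IsGaussianProcess (Sum.elim (postResidual f ε k σ a e) (noisyObs f ε a e)) P := by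
  classical
  -- Coordinate projections extended by zero outside `I`, so that the linear combinations below need
  -- no membership proofs.
  let π (I : Finset (X ⊕ ι)) (s : X ⊕ ι) : (I → ℝ) →L[ℝ] ℝ :=
    if hs : s ∈ I then ContinuousLinearMap.proj ⟨s, hs⟩ else 0
  have hπ (I : Finset (X ⊕ ι)) (s : X ⊕ ι) (hs : s ∈ I) (ω : Ω) :
      π I s (I.restrict (Sum.elim f ε · ω)) = Sum.elim f ε s ω := by
    simp [π, hs]
  let J : Finset (X ⊕ ι) := Finset.univ.image (fun i => Sum.inl (a i))
    ∪ Finset.univ.image (fun i => Sum.inr (e i))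
  refine IsGaussianProcess.of_isGaussianProcess h.gaussian fun s => ?_
  have hJ1 (I : Finset (X ⊕ ι)) (hI : J ⊆ I) (i : Fin n) : Sum.inl (a i) ∈ I :=
    hI (Finset.mem_union_left _ (Finset.mem_image_of_mem _ (Finset.mem_univ i)))
  have hJ2 (I : Finset (X ⊕ ι)) (hI : J ⊆ I) (i : Fin n) : Sum.inr (e i) ∈ I :=
    hI (Finset.mem_union_right _ (Finset.mem_image_of_mem (fun i => Sum.inr (e i))
      (Finset.mem_univ i)))
  rcases s with x | i
  · let I := insert (Sum.inl x) J
    refine ⟨I, π I (Sum.inl x)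
      - ∑ i, postWeights k σ a x i • (π I (Sum.inl (a i)) + π I (Sum.inr (e i))), fun ω => ?_⟩
    simp only [sub_apply, sum_apply,
      smul_apply, add_apply]
    rw [hπ I _ (Finset.mem_insert_self _ _)]
    simp only [hπ I _ (hJ1 I (Finset.subset_insert _ _) _),
      hπ I _ (hJ2 I (Finset.subset_insert _ _) _)]
    rfl
  · refine ⟨J, π J (Sum.inl (a i)) + π J (Sum.inr (e i)), fun ω => ?_⟩
    simp only [add_apply]
    rw [hπ J _ (hJ1 J subset_rfl i), hπ J _ (hJ2 J subset_rfl i)]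
    rfl

/-- Uncorrelated and jointly Gaussian implies independent. This replaces the computation of a
conditional law of `f` given the data. -/
theorem indepFun_residual_noisyObs (h : IsNoisyGP f ε k σ P) (hk : (Matrix.of k).PosSemidef)
    (hσ : 0 < σ) (a : Fin n → X) {e : Fin n → ι} (he : Function.Injective e) :
    IndepFun (fun ω x => postResidual f ε k σ a e x ω) (fun ω i => noisyObs f ε a e i ω) P :=
  (h.isGaussianProcess_residual_noisyObs a e).indepFun_of_covariance_eq_zero
    (fun x => (h.measurable_residual a e x).aemeasurable)
    (fun i => (h.measurable_noisyObs a e i).aemeasurable)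
    (h.cov_residual_noisyObs hk hσ a he)

theorem hasLaw_residual (h : IsNoisyGP f ε k σ P) (hk : (Matrix.of k).PosSemidef)
    (hσ : 0 < σ) (a : Fin n → X) {e : Fin n → ι} (he : Function.Injective e) (x : X) :
    HasLaw (postResidual f ε k σ a e x) (gaussianReal 0 (queryVar k σ a x).toNNReal) P where
  aemeasurable := (h.measurable_residual a e x).aemeasurable
  map_eq := by
    have h1 : HasGaussianLaw (postResidual f ε k σ a e x) P :=
      (h.isGaussianProcess_residual_noisyObs a e).hasGaussianLaw_eval (Sum.inl x)
    rw [h1.map_eq_gaussianReal, h.variance_residual hk hσ a he, h.integral_residual]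

end IsNoisyGP

theorem HasGaussianLaw.isGaussianProcess {Ω ι : Type*} [MeasurableSpace Ω] [Fintype ι]
    {P : Measure Ω} {X : ι → Ω → ℝ} (h : HasGaussianLaw (fun ω i => X i ω) P) :
    IsGaussianProcess X P where
  hasGaussianLaw I :=
    h.map (ContinuousLinearMap.pi fun i : I => ContinuousLinearMap.proj (R := ℝ) (φ := fun _ => ℝ) i.1)

theorem IsGaussianProcess.hasGaussianLaw_pi {Ω ι : Type*} [MeasurableSpace Ω] [Fintype ι]
    {P : Measure Ω} {X : ι → Ω → ℝ} (h : IsGaussianProcess X P) :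
    HasGaussianLaw (fun ω i => X i ω) P :=
  (h.hasGaussianLaw Finset.univ).map (ContinuousLinearMap.pi fun i : ι =>
    ContinuousLinearMap.proj (R := ℝ) (φ := fun _ : (Finset.univ : Finset ι) => ℝ)
      ⟨i, Finset.mem_univ i⟩)

/-- A centred Gaussian process on a finite domain together with independent i.i.d. Gaussian noise. -/
theorem IsNoisyGP.of_indepFun {Ω X ι : Type*} [MeasurableSpace Ω] {P : Measure Ω}
    [Fintype X] [Fintype ι] [DecidableEq ι] {f : X → Ω → ℝ} {ε : ι → Ω → ℝ} {k : X → X → ℝ} {σ : ℝ}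
    (hfm : ∀ x, Measurable (f x)) (hεm : ∀ i, Measurable (ε i)) (hf : IsCenteredGP f k P)
    (hε : ∀ i, HasLaw (ε i) (gaussianReal 0 (noiseVar σ)) P) (hεi : iIndepFun ε P)
    (hind : IndepFun (fun ω x => f x ω) (fun ω i => ε i ω) P) : IsNoisyGP f ε k σ P := by
  have hεg : HasGaussianLaw (fun ω i => ε i ω) P :=
    hεi.hasGaussianLaw fun i => (hε i).hasGaussianLaw
  have hfg := IsGaussianProcess.hasGaussianLaw_pi hf.isGaussianProcess
  have hjoint := hind.hasGaussianLaw hfg hεg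
  have hmean : ∀ i, ∫ ω, ε i ω ∂P = 0 := fun i => by
    rw [(hε i).integral_eq, integral_id_gaussianReal]
  refine ⟨?_, hfm, hεm, hf.mean_zero, hmean, hf.covariance_eq, fun x i => ?_, fun i j => ?_⟩
  · refine HasGaussianLaw.isGaussianProcess ?_
    have h1 := hjoint.map (ContinuousLinearMap.pi (fun s : X ⊕ ι => Sum.elim
      (fun x => (ContinuousLinearMap.proj (R := ℝ) (φ := fun _ : X => ℝ) x).comp
        (ContinuousLinearMap.fst ℝ (X → ℝ) (ι → ℝ)))
      (fun i => (ContinuousLinearMap.proj (R := ℝ) (φ := fun _ : ι => ℝ) i).comp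
        (ContinuousLinearMap.snd ℝ (X → ℝ) (ι → ℝ))) s))
    refine h1.congr (Filter.Eventually.of_forall fun ω => ?_)
    funext s
    rcases s with x | i <;> simp
  · exact (hind.comp (measurable_pi_apply x) (measurable_pi_apply i)).covariance_eq_zero
      (hfg.eval x).memLp_two (hεg.eval i).memLp_two
  · split_ifs with hij
    · subst hij
      rw [covariance_self (hεm i).aemeasurable, (hε i).variance_eq, variance_id_gaussianReal]
      rfl
    · exact (hεi.indepFun hij).covariance_eq_zero (hεg.eval i).memLp_two (hεg.eval j).memLp_two

/-! ### Mutual information of a signal observed in Gaussian noise. -/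

theorem pi_gaussianReal_eq_withDensity {ι : Type*} [Fintype ι] {v : ι → ℝ≥0} (hv : ∀ i, v i ≠ 0) :
    Measure.pi (fun i => gaussianReal 0 (v i))
      = (volume : Measure (ι → ℝ)).withDensity
        (fun y => ENNReal.ofReal (∏ i, gaussianPDFReal 0 (v i) (y i))) := by
  refine Measure.pi_eq fun s hs => ?_
  rw [withDensity_apply _ (MeasurableSet.univ_pi hs),
    ← lintegral_indicator (MeasurableSet.univ_pi hs)]
  have h1 : ∀ y : ι → ℝ, (Set.univ.pi s).indicator
      (fun y => ENNReal.ofReal (∏ i, gaussianPDFReal 0 (v i) (y i))) y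
      = ENNReal.ofReal (∏ i, (s i).indicator (gaussianPDFReal 0 (v i)) (y i)) := by
    intro y
    by_cases hy : y ∈ Set.univ.pi s
    · rw [Set.indicator_of_mem hy]
      congr 1
      exact Finset.prod_congr rfl fun i _ =>
        (Set.indicator_of_mem (hy i (Set.mem_univ i)) _).symm
    · rw [Set.indicator_of_notMem hy]
      simp only [Set.mem_univ_pi, not_forall] at hy
      obtain ⟨i, hi⟩ := hy
      rw [Finset.prod_eq_zero (Finset.mem_univ i) (Set.indicator_of_notMem hi _),
        ENNReal.ofReal_zero]
  have hint : ∀ i, Integrable ((s i).indicator (gaussianPDFReal 0 (v i))) := fun i =>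
    (integrable_gaussianPDFReal 0 (v i)).indicator (hs i)
  have hnn : ∀ i x, 0 ≤ (s i).indicator (gaussianPDFReal 0 (v i)) x := fun i x =>
    Set.indicator_nonneg (fun x _ => gaussianPDFReal_nonneg _ _ _) x
  rw [lintegral_congr h1, volume_pi, ← ofReal_integral_eq_lintegral_ofReal
    (Integrable.fintype_prod hint)
    (Filter.Eventually.of_forall fun y => Finset.prod_nonneg fun i _ => hnn i (y i)),
    integral_fintype_prod_eq_prod,
    ENNReal.ofReal_prod_of_nonneg fun i _ => integral_nonneg (hnn i)]
  refine Finset.prod_congr rfl fun i _ => ?_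
  rw [integral_indicator (hs i), gaussianReal_apply_eq_integral _ (hv i)]

/-- Finiteness is recorded next to the value because `toReal` sends `∞` to `0`, and a supremum of
such divergences is compared later. -/
theorem klDiv_withDensity {α : Type*} [MeasurableSpace α] {μ ν : Measure α} [IsProbabilityMeasure μ]
    [IsProbabilityMeasure ν] {ρ : α → ℝ≥0∞} (hρ : Measurable ρ) (hμ : μ = ν.withDensity ρ)
    (hint : Integrable (fun x => Real.log (ρ x).toReal) μ) :
    InformationTheory.klDiv μ ν ≠ ∞ ∧
      (InformationTheory.klDiv μ ν).toReal = ∫ x, Real.log (ρ x).toReal ∂μ := by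
  have hac : μ ≪ ν := hμ ▸ withDensity_absolutelyContinuous ν ρ
  have h1 : μ.rnDeriv ν =ᵐ[ν] ρ := by
    rw [hμ]
    exact Measure.rnDeriv_withDensity ν hρ
  have h2 : llr μ ν =ᵐ[μ] fun x => Real.log (ρ x).toReal := by
    filter_upwards [hac.ae_le h1] with x hx
    rw [llr, hx]
  exact ⟨InformationTheory.klDiv_ne_top hac ((integrable_congr h2).2 hint), by
    rw [InformationTheory.toReal_klDiv_of_measure_eq hac (by simp), integral_congr_ae h2]⟩

theorem log_gaussianPDFReal {v : ℝ≥0} (hv : v ≠ 0) (x : ℝ) :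
    Real.log (gaussianPDFReal 0 v x) = -(Real.log (2 * Real.pi * v) / 2) - x ^ 2 / (2 * v) := by
  have hv' : 0 < (v : ℝ) := NNReal.coe_pos.2 (pos_iff_ne_zero.2 hv)
  have hp : 0 < 2 * Real.pi * v := by positivity
  rw [gaussianPDFReal, Real.log_mul (by positivity) (Real.exp_pos _).ne', Real.log_exp,
    Real.log_inv, Real.log_sqrt hp.le, sub_zero]
  ring

theorem measurePreserving_mulVec {ι : Type*} [Fintype ι] [DecidableEq ι] {L : Matrix ι ι ℝ}
    (hL : L.det = 1) : MeasurePreserving (fun y : ι → ℝ => L.mulVec y) volume volume where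
  measurable := by
    have : Continuous fun y : ι → ℝ => L.mulVec y := by fun_prop
    exact this.measurable
  map_eq := by
    have h := Real.map_matrix_volume_pi_eq_smul_volume_pi (M := L) (by rw [hL]; exact one_ne_zero)
    rw [hL] at h
    rw [show (fun y => L.mulVec y) = ⇑(Matrix.toLin' L) from
      funext fun y => (Matrix.toLin'_apply L y).symm]
    simpa using h

theorem map_withDensity_comp {α β : Type*} [MeasurableSpace α] [MeasurableSpace β] {μ : Measure α}
    {ν : Measure β} {L : α → β} (hL : MeasurePreserving L μ ν) {g : β → ℝ≥0∞} (hg : Measurable g) :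
    (μ.withDensity fun y => g (L y)).map L = ν.withDensity g := by
  ext s hs
  rw [Measure.map_apply hL.measurable hs, withDensity_apply _ (hL.measurable hs),
    withDensity_apply _ hs, hL.setLIntegral_comp_preimage hs hg]

/-- A unimodular change of variables has no Jacobian factor, so the density of `Y` is that of its
decorrelated image composed with `L`. -/
theorem map_eq_withDensity_of_mulVec {Ω ι : Type*} [MeasurableSpace Ω] [Fintype ι] [DecidableEq ι]
    {P : Measure Ω} {L : Matrix ι ι ℝ} (hL : L.det = 1) {Y : Ω → ι → ℝ} (hY : Measurable Y)
    {g : (ι → ℝ) → ℝ≥0∞} (hg : Measurable g)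
    (h : P.map (fun ω => L.mulVec (Y ω)) = volume.withDensity g) :
    P.map Y = volume.withDensity fun y => g (L.mulVec y) := by
  have hLm := measurePreserving_mulVec hL
  have hLi : Measurable fun y : ι → ℝ => L⁻¹.mulVec y := by
    have : Continuous fun y : ι → ℝ => L⁻¹.mulVec y := by fun_prop
    exact this.measurable
  have hinv : (fun y : ι → ℝ => L⁻¹.mulVec y) ∘ (fun y => L.mulVec y) = id := by
    funext y
    simp [Matrix.mulVec_mulVec, Matrix.nonsing_inv_mul L (by simp [hL])]
  have key (μ : Measure (ι → ℝ)) :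
      (μ.map fun y => L.mulVec y).map (fun y => L⁻¹.mulVec y) = μ := by
    rw [Measure.map_map hLi hLm.measurable, hinv, Measure.map_id]
  rw [← key (P.map Y), ← key (volume.withDensity _), map_withDensity_comp hLm hg,
    Measure.map_map hLm.measurable hY]
  exact congrArg (fun μ => Measure.map (fun y => L⁻¹.mulVec y) μ) h

/-- The joint law of a noisy signal and the signal has a density with respect to the product of the
marginal laws. -/
theorem map_prodMk_add_eq_withDensity {Ω ι : Type*} [MeasurableSpace Ω] [Fintype ι]
    {P : Measure Ω} [IsProbabilityMeasure P] {F ε : Ω → ι → ℝ} (hF : Measurable F)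
    (hε : Measurable ε) (hind : IndepFun F ε P) {φ q : (ι → ℝ) → ℝ} (hφ : Measurable φ)
    (hq : Measurable q) (hq0 : ∀ y, 0 < q y)
    (hεd : P.map ε = volume.withDensity fun y => ENNReal.ofReal (φ y))
    (hYd : P.map (fun ω => F ω + ε ω) = volume.withDensity fun y => ENNReal.ofReal (q y)) :
    P.map (fun ω => (F ω + ε ω, F ω)) = ((P.map fun ω => F ω + ε ω).prod (P.map F)).withDensity
      fun p => ENNReal.ofReal (φ (p.1 - p.2) / q p.1) := by
  have hρ : Measurable fun p : (ι → ℝ) × (ι → ℝ) => ENNReal.ofReal (φ (p.1 - p.2) / q p.1) :=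
    ((hφ.comp (measurable_fst.sub measurable_snd)).div (hq.comp measurable_fst)).ennreal_ofReal
  have := Measure.isProbabilityMeasure_map (μ := P) hF.aemeasurable
  have := Measure.isProbabilityMeasure_map (μ := P) hε.aemeasurable
  have := Measure.isProbabilityMeasure_map (μ := P) (hF.add hε).aemeasurable
  have hadd : Measurable fun p : (ι → ℝ) × (ι → ℝ) => (p.1 + p.2, p.1) := by fun_prop
  -- Given `F = w`, the noisy signal has density `φ (y - w)`. Only the noise and the noisy signal
  -- need densities, so the law of `F` may be singular, as it is when a design repeats a point.
  have hmap : P.map (fun ω => (F ω + ε ω, F ω))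
      = ((P.map F).prod (P.map ε)).map fun p => (p.1 + p.2, p.1) := by
    rw [← (indepFun_iff_map_prod_eq_prod_map_map hF.aemeasurable hε.aemeasurable).1 hind,
      Measure.map_map hadd (hF.prodMk hε)]
    rfl
  refine Measure.ext_of_lintegral _ fun h hh => ?_
  rw [hmap, lintegral_map hh hadd, 
    lintegral_prod (fun p : (ι → ℝ) × (ι → ℝ) => h (p.1 + p.2, p.1)) (hh.comp hadd).aemeasurable,
    lintegral_withDensity_eq_lintegral_mul _ hρ hh,
    lintegral_prod_symm _ (hρ.mul hh).aemeasurable]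
  refine lintegral_congr fun w => ?_
  have hsec : Measurable fun y : ι → ℝ => h (y, w) := by fun_prop
  have hφw : Measurable fun y => ENNReal.ofReal (φ (y - w)) :=
    (hφ.comp (measurable_id.sub_const w)).ennreal_ofReal
  have hm1 : Measurable fun e : ι → ℝ => h (w + e, w) := by fun_prop
  have hm2 : Measurable fun y : ι → ℝ => ENNReal.ofReal (φ (y - w) / q y) * h (y, w) :=
    (((hφ.comp (measurable_id.sub_const w)).div hq).ennreal_ofReal).mul hsec
  calc ∫⁻ e, h (w + e, w) ∂P.map ε
      = ∫⁻ e, ENNReal.ofReal (φ (w + e - w)) * h (w + e, w) := by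
        rw [hεd, lintegral_withDensity_eq_lintegral_mul _ hφ.ennreal_ofReal hm1]
        simp
    _ = ∫⁻ y, ENNReal.ofReal (φ (y - w)) * h (y, w) :=
        lintegral_add_left_eq_self (fun y => ENNReal.ofReal (φ (y - w)) * h (y, w)) w
    _ = ∫⁻ y, ENNReal.ofReal (q y) * (ENNReal.ofReal (φ (y - w) / q y) * h (y, w)) := by
        refine lintegral_congr fun y => ?_
        rw [← mul_assoc, ← ENNReal.ofReal_mul (hq0 y).le, mul_div_cancel₀ _ (hq0 y).ne']
    _ = ∫⁻ y, ENNReal.ofReal (φ (y - w) / q y) * h (y, w) ∂P.map (fun ω => F ω + ε ω) := by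
        rw [hYd, lintegral_withDensity_eq_lintegral_mul _ hq.ennreal_ofReal hm2]
        rfl

theorem integral_sq_of_hasLaw {Ω : Type*} [MeasurableSpace Ω] {P : Measure Ω} {Z : Ω → ℝ} {v : ℝ≥0}
    (h : HasLaw Z (gaussianReal 0 v) P) :
    Integrable (fun ω => Z ω ^ 2) P ∧ ∫ ω, Z ω ^ 2 ∂P = v := by
  have hg : HasGaussianLaw Z P := h.hasGaussianLaw
  have := hg.isProbabilityMeasure
  refine ⟨hg.memLp_two.integrable_sq, ?_⟩
  have h1 : ∫ ω, Z ω ∂P = 0 := by rw [h.integral_eq, integral_id_gaussianReal]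
  have h2 := variance_of_integral_eq_zero h.aemeasurable h1
  rw [h.variance_eq, variance_id_gaussianReal] at h2
  exact h2.symm

set_option maxHeartbeats 1000000 in
/-- The mutual information of a noisy Gaussian signal and the signal, when a unimodular linear map
decorrelates the noisy signal. -/
theorem mutualInfo_gaussian {Ω ι : Type*} [MeasurableSpace Ω] [Fintype ι] [DecidableEq ι]
    {P : Measure Ω} [IsProbabilityMeasure P] {F ε : Ω → ι → ℝ} (hF : Measurable F)
    (hε : Measurable ε) (hind : IndepFun F ε P) {L : Matrix ι ι ℝ} (hL : L.det = 1)
    {s v : ι → ℝ≥0} (hs : ∀ i, s i ≠ 0) (hv : ∀ i, v i ≠ 0)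
    (hεl : HasLaw ε (Measure.pi fun i => gaussianReal 0 (s i)) P)
    (hYl : HasLaw (fun ω => L.mulVec (F ω + ε ω)) (Measure.pi fun i => gaussianReal 0 (v i)) P) :
    mutualInfo P (fun ω => F ω + ε ω) F ≠ ∞ ∧
      (mutualInfo P (fun ω => F ω + ε ω) F).toReal
        = ∑ i, (Real.log (v i) - Real.log (s i)) / 2 := by
  set φ : (ι → ℝ) → ℝ := fun y => ∏ i, gaussianPDFReal 0 (s i) (y i) with hφdef
  set q : (ι → ℝ) → ℝ := fun y => ∏ i, gaussianPDFReal 0 (v i) (L.mulVec y i) with hqdef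
  have hpm (v : ι → ℝ≥0) : Measurable fun y : ι → ℝ => ∏ i, gaussianPDFReal 0 (v i) (y i) :=
    Finset.measurable_fun_prod _ fun i _ =>
      (measurable_gaussianPDFReal 0 (v i)).comp (measurable_pi_apply i)
  have hLm := (measurePreserving_mulVec hL).measurable
  have hφm : Measurable φ := hpm s
  have hqm : Measurable q := (hpm v).comp hLm
  have hφ0 (y) : 0 < φ y := Finset.prod_pos fun i _ => gaussianPDFReal_pos _ _ _ (hs i)
  have hq0 (y) : 0 < q y := Finset.prod_pos fun i _ => gaussianPDFReal_pos _ _ _ (hv i)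
  have hYd : P.map (fun ω => F ω + ε ω) = volume.withDensity fun y => ENNReal.ofReal (q y) :=
    map_eq_withDensity_of_mulVec hL (hF.add hε) (hpm v).ennreal_ofReal
      (hYl.map_eq.trans (pi_gaussianReal_eq_withDensity hv))
  have hjoint := map_prodMk_add_eq_withDensity hF hε hind hφm hqm hq0
    (hεl.map_eq.trans (pi_gaussianReal_eq_withDensity hs)) hYd
  have hρ : Measurable fun p : (ι → ℝ) × (ι → ℝ) => ENNReal.ofReal (φ (p.1 - p.2) / q p.1) :=
    ((hφm.comp (measurable_fst.sub measurable_snd)).div (hqm.comp measurable_fst)).ennreal_ofReal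
  have := Measure.isProbabilityMeasure_map (μ := P) hF.aemeasurable
  have := Measure.isProbabilityMeasure_map (μ := P) (hF.add hε).aemeasurable
  have hYF : Measurable fun ω => (F ω + ε ω, F ω) := by fun_prop
  have := Measure.isProbabilityMeasure_map (μ := P) hYF.aemeasurable
  have hlogm : Measurable fun p : (ι → ℝ) × (ι → ℝ) =>
      Real.log (ENNReal.ofReal (φ (p.1 - p.2) / q p.1)).toReal :=
    Real.measurable_log.comp hρ.ennreal_toReal
  have heval (i : ι) (v : ι → ℝ≥0) : HasLaw (fun y : ι → ℝ => y i) (gaussianReal 0 (v i))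
      (Measure.pi fun i => gaussianReal 0 (v i)) :=
    (measurePreserving_eval (fun i => gaussianReal 0 (v i)) i).hasLaw
  have hε2 (i : ι) := integral_sq_of_hasLaw ((heval i s).fun_comp hεl)
  have hY2 (i : ι) := integral_sq_of_hasLaw ((heval i v).fun_comp hYl)
  have hlog (ω : Ω) : Real.log (ENNReal.ofReal (φ (F ω + ε ω - F ω) / q (F ω + ε ω))).toReal
      = ∑ i, ((Real.log (v i) - Real.log (s i)) / 2 - ε ω i ^ 2 / (2 * s i)
        + L.mulVec (F ω + ε ω) i ^ 2 / (2 * v i)) := by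
    rw [ENNReal.toReal_ofReal (div_pos (hφ0 _) (hq0 _)).le,
      Real.log_div (hφ0 _).ne' (hq0 _).ne', add_sub_cancel_left]
    simp only [hφdef, hqdef]
    rw [Real.log_prod fun i _ => (gaussianPDFReal_pos _ _ _ (hs i)).ne',
      Real.log_prod fun i _ => (gaussianPDFReal_pos _ _ _ (hv i)).ne', ← Finset.sum_sub_distrib]
    refine Finset.sum_congr rfl fun i _ => ?_
    have hs' : (s i : ℝ) ≠ 0 := by simpa using hs i
    have hv' : (v i : ℝ) ≠ 0 := by simpa using hv i
    rw [log_gaussianPDFReal (hs i), log_gaussianPDFReal (hv i),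
      Real.log_mul (by positivity) hs', Real.log_mul (by positivity) hv']
    ring
  have hI1 (i : ι) : Integrable (fun ω => (Real.log (v i) - Real.log (s i)) / 2
      - ε ω i ^ 2 / (2 * s i)) P :=
    (integrable_const _).sub ((hε2 i).1.div_const _)
  have hI2 (i : ι) : Integrable (fun ω => L.mulVec (F ω + ε ω) i ^ 2 / (2 * v i)) P :=
    (hY2 i).1.div_const _
  have hI3 (i : ι) : Integrable (fun ω => (Real.log (v i) - Real.log (s i)) / 2
      - ε ω i ^ 2 / (2 * s i) + L.mulVec (F ω + ε ω) i ^ 2 / (2 * v i)) P := (hI1 i).add (hI2 i)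
  have hint : Integrable (fun ω => Real.log
      (ENNReal.ofReal (φ (F ω + ε ω - F ω) / q (F ω + ε ω))).toReal) P := by
    simp only [hlog]
    exact integrable_finsetSum _ fun i _ => hI3 i
  obtain ⟨h1, h2⟩ := klDiv_withDensity hρ hjoint
    ((integrable_map_measure hlogm.aestronglyMeasurable hYF.aemeasurable).2 hint)
  refine ⟨h1, ?_⟩
  rw [mutualInfo, h2, integral_map hYF.aemeasurable hlogm.aestronglyMeasurable]
  simp only [hlog]
  rw [integral_finsetSum _ fun i _ => hI3 i]
  refine Finset.sum_congr rfl fun i _ => ?_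
  have hs' : (s i : ℝ) ≠ 0 := by simpa using hs i
  have hv' : (v i : ℝ) ≠ 0 := by simpa using hv i
  -- The two quadratic terms have expectation `1 / 2` each and cancel, leaving only the log
  -- variances.
  rw [integral_add (hI1 i) (hI2 i), integral_sub (integrable_const _) ((hε2 i).1.div_const _),
    integral_const, probReal_univ, one_smul, integral_div, integral_div, (hε2 i).2, (hY2 i).2]
  field_simp
  ring

/-! ### Innovations, and the information gain as a sum over rounds. -/

/-- The first `t` entries of a tuple. -/
def tuplePrefix {α : Type*} {T : ℕ} (a : Fin T → α) (t : Fin T) (i : Fin t) : α :=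
  a (Fin.castLE t.is_lt.le i)

/-- The unit lower triangular matrix that maps the noisy observations at `a` to their
one-step-ahead prediction errors. -/
noncomputable def innovationMatrix {X : Type*} (k : X → X → ℝ) (σ : ℝ) {T : ℕ} (a : Fin T → X) :
    Matrix (Fin T) (Fin T) ℝ :=
  Matrix.of fun t i => if h : (i : ℕ) < t then -postWeights k σ (tuplePrefix a t) (a t) ⟨i, h⟩
    else if i = t then 1 else 0

theorem det_innovationMatrix {X : Type*} (k : X → X → ℝ) (σ : ℝ) {T : ℕ} (a : Fin T → X) :
    (innovationMatrix k σ a).det = 1 := by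
  rw [Matrix.det_of_isLowerTriangular]
  · exact Finset.prod_eq_one fun i _ => by simp [innovationMatrix]
  · intro i j hij
    have h : i < j := hij
    simp only [innovationMatrix, Matrix.of_apply]
    rw [dif_neg (by simpa using h.le), if_neg h.ne']

theorem sum_castLE {T : ℕ} (t : Fin T) (g : Fin t → ℝ) (h : Fin T → ℝ)
    (hg : ∀ i : Fin t, h (Fin.castLE t.is_lt.le i) = g i) (h0 : ∀ i, t < i → h i = 0) :
    ∑ i, h i = h t + ∑ i, g i := by
  have hinj : Function.Injective (Fin.castLE t.is_lt.le) := Fin.castLE_injective _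
  have ht : t ∉ Finset.univ.map ⟨Fin.castLE t.is_lt.le, hinj⟩ := by
    simp only [Finset.mem_map, Finset.mem_univ, true_and, Function.Embedding.coeFn_mk, not_exists]
    intro i hi
    have := congrArg Fin.val hi
    simp at this
    omega
  rw [← Finset.sum_subset (Finset.subset_univ
    (insert t (Finset.univ.map ⟨Fin.castLE t.is_lt.le, hinj⟩))), Finset.sum_insert ht,
    Finset.sum_map]
  · simp [hg]
  · intro i _ hi
    rw [Finset.mem_insert, not_or] at hi
    refine h0 i (lt_of_le_of_ne (le_of_not_gt fun hlt => hi.2 ?_) (Ne.symm hi.1))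
    exact Finset.mem_map.2 ⟨⟨i, hlt⟩, Finset.mem_univ _, rfl⟩

section

variable {Ω X : Type*} {T : ℕ} {f : X → Ω → ℝ}
  {ε : Fin T → Ω → ℝ} {k : X → X → ℝ} {σ : ℝ}

theorem innovationMatrix_mulVec (a : Fin T → X) (y : Fin T → ℝ) (t : Fin T) :
    (innovationMatrix k σ a).mulVec y t
      = y t + ∑ i, -postWeights k σ (tuplePrefix a t) (a t) i * tuplePrefix y t i := by
  rw [Matrix.mulVec, dotProduct, sum_castLE t
    (fun i => -postWeights k σ (tuplePrefix a t) (a t) i * tuplePrefix y t i)]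
  · simp [innovationMatrix]
  · intro i
    have h : ((Fin.castLE t.is_lt.le i : Fin T) : ℕ) < t := i.is_lt
    simp only [innovationMatrix, Matrix.of_apply]
    rw [dif_pos h]
    rfl
  · intro i hi
    simp only [innovationMatrix, Matrix.of_apply]
    rw [dif_neg (by simpa using hi.le), if_neg hi.ne', zero_mul]

/-- The one-step-ahead prediction error of the observation at `a t`. -/
noncomputable def innovation (f : X → Ω → ℝ) (ε : Fin T → Ω → ℝ) (k : X → X → ℝ) (σ : ℝ)
    (a : Fin T → X) (t : Fin T) (ω : Ω) : ℝ :=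
  postResidual f ε k σ (tuplePrefix a t) (tuplePrefix id t) (a t) ω + ε t ω

theorem innovationMatrix_mulVec_noisyObs (a : Fin T → X) (ω : Ω) (t : Fin T) :
    (innovationMatrix k σ a).mulVec (fun i => noisyObs f ε a id i ω) t
      = innovation f ε k σ a t ω := by
  rw [innovationMatrix_mulVec, innovation, postResidual]
  simp only [noisyObs, tuplePrefix, id_eq, neg_mul, Finset.sum_neg_distrib]
  ring

theorem tuplePrefix_id_injective (t : Fin T) :
    Function.Injective (tuplePrefix (id : Fin T → Fin T) t) :=
  Fin.castLE_injective t.is_lt.le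

theorem tuplePrefix_id_lt (t : Fin T) (i : Fin t) : tuplePrefix (id : Fin T → Fin T) t i < t :=
  i.is_lt

namespace IsNoisyGP

variable [MeasurableSpace Ω] {P : Measure Ω}

theorem memLp_innovation (h : IsNoisyGP f ε k σ P) (a : Fin T → X) (t : Fin T) :
    MemLp (innovation f ε k σ a t) 2 P :=
  (h.memLp_residual _ _ _).add (h.memLp_noise t)

theorem cov_residual_noise (h : IsNoisyGP f ε k σ P) {n : ℕ} (a : Fin n → X) (e : Fin n → Fin T)
    (x : X) (j : Fin T) (hj : ∀ i, j ≠ e i) :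
    cov[postResidual f ε k σ a e x, ε j; P] = 0 := by
  have := h.isProbabilityMeasure
  have h1 := covariance_fun_sub_left (h.memLp_f x) (h.memLp_sum_noisyObs a e (postWeights k σ a x))
    (h.memLp_noise j)
  rw [h.cov_f_noise, covariance_comm (fun ω => ∑ i, _), h.cov_sum_noisyObs a (h.memLp_noise j)] at h1
  simp only [h.cov_noise_noisyObs, hj, if_false, zero_mul, Finset.sum_const_zero, sub_zero] at h1
  exact h1

/-- The residual at step `t` is orthogonal to the observations before `t`, and the fresh noise `ε t`
occurs in none of them. -/
theorem cov_innovation_noisyObs (h : IsNoisyGP f ε k σ P) (hk : (Matrix.of k).PosSemidef)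
    (hσ : 0 < σ) (a : Fin T → X) {i t : Fin T} (hit : i < t) :
    cov[innovation f ε k σ a t, noisyObs f ε a id i; P] = 0 := by
  have := h.isProbabilityMeasure
  have h1 := covariance_add_left (h.memLp_residual (tuplePrefix a t) (tuplePrefix id t) (a t))
    (h.memLp_noise t) (h.memLp_noisyObs a id i)
  have h2 : cov[postResidual f ε k σ (tuplePrefix a t) (tuplePrefix id t) (a t),
      noisyObs f ε a id i; P] = 0 :=
    h.cov_residual_noisyObs hk hσ (tuplePrefix a t) (tuplePrefix_id_injective t) (a t) ⟨i, hit⟩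
  rw [h2, h.cov_noise_noisyObs, if_neg (by simpa using hit.ne'), add_zero] at h1
  exact h1

/-- An earlier innovation is a combination of observations up to its own time, all of which precede
`t`. -/
theorem cov_innovation_of_lt (h : IsNoisyGP f ε k σ P) (hk : (Matrix.of k).PosSemidef)
    (hσ : 0 < σ) (a : Fin T → X) {s t : Fin T} (hst : s < t) :
    cov[innovation f ε k σ a t, innovation f ε k σ a s; P] = 0 := by
  have := h.isProbabilityMeasure
  have h1 : innovation f ε k σ a s
      = fun ω => ∑ i, innovationMatrix k σ a s i * noisyObs f ε a id i ω := by
    funext ω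
    rw [← innovationMatrix_mulVec_noisyObs]
    rfl
  rw [h1, h.cov_sum_noisyObs a (h.memLp_innovation a t)]
  refine Finset.sum_eq_zero fun i _ => ?_
  rcases lt_or_ge i t with hit | hit
  · rw [h.cov_innovation_noisyObs hk hσ a hit, zero_mul]
  -- Row `s` of the triangular matrix vanishes here, as `s < t ≤ i`.
  · have : ¬ (i : ℕ) < s := by
      have : s < i := hst.trans_le hit
      simpa using this.le
    simp only [innovationMatrix, Matrix.of_apply]
    rw [dif_neg this, if_neg (hst.trans_le hit).ne', mul_zero]

theorem variance_innovation (h : IsNoisyGP f ε k σ P) (hk : (Matrix.of k).PosSemidef)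
    (hσ : 0 < σ) (a : Fin T → X) (t : Fin T) :
    Var[innovation f ε k σ a t; P] = queryVar k σ (tuplePrefix a t) (a t) + σ ^ 2 := by
  have := h.isProbabilityMeasure
  have h1 := variance_add (h.memLp_residual (tuplePrefix a t) (tuplePrefix id t) (a t))
    (h.memLp_noise t)
  rw [h.variance_residual hk hσ _ (tuplePrefix_id_injective t),
    h.cov_residual_noise _ _ _ _ (fun i => (tuplePrefix_id_lt t i).ne'),
    ← covariance_self (h.measurable_noise t).aemeasurable, h.cov_noise, if_pos rfl, mul_zero,
    add_zero] at h1
  exact h1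

theorem hasGaussianLaw_innovation (h : IsNoisyGP f ε k σ P) (a : Fin T → X) :
    HasGaussianLaw (fun ω t => innovation f ε k σ a t ω) P := by
  have h1 : HasGaussianLaw (fun ω i => noisyObs f ε a id i ω) P :=
    IsGaussianProcess.hasGaussianLaw_pi
      ((h.isGaussianProcess_residual_noisyObs a id).comp_right Sum.inr)
  have h2 := h1.map (LinearMap.toContinuousLinearMap (Matrix.toLin' (innovationMatrix k σ a)))
  refine h2.congr (Filter.Eventually.of_forall fun ω => ?_)
  funext t
  exact innovationMatrix_mulVec_noisyObs a ω t

theorem hasLaw_innovation (h : IsNoisyGP f ε k σ P) (hk : (Matrix.of k).PosSemidef)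
    (hσ : 0 < σ) (a : Fin T → X) :
    HasLaw (fun ω t => innovation f ε k σ a t ω)
      (Measure.pi fun t => gaussianReal 0
        (queryVar k σ (tuplePrefix a t) (a t) + σ ^ 2).toNNReal) P := by
  have hg := h.hasGaussianLaw_innovation (k := k) (σ := σ) a
  refine iIndepFun.hasLaw_pi (fun t => ?_) (hg.iIndepFun_of_covariance_eq_zero fun s t hst => ?_)
  · refine ⟨(hg.eval t).aemeasurable, ?_⟩
    have hm : ∫ ω, innovation f ε k σ a t ω ∂P = 0 := by
      simp only [innovation]
      have := h.isProbabilityMeasure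
      rw [integral_add ((h.memLp_residual _ _ _).integrable (by norm_num)) (h.integrable_noise t),
        h.integral_residual, h.mean_noise, add_zero]
    have h1 : HasGaussianLaw (innovation f ε k σ a t) P := hg.eval t
    rw [h1.map_eq_gaussianReal, h.variance_innovation hk hσ, hm]
  · rcases lt_or_gt_of_ne hst with hlt | hlt
    · rw [covariance_comm]
      exact h.cov_innovation_of_lt hk hσ a hlt
    · exact h.cov_innovation_of_lt hk hσ a hlt

theorem hasLaw_noise (h : IsNoisyGP f ε k σ P) :
    HasLaw (fun ω t => ε t ω) (Measure.pi fun _ => gaussianReal 0 (noiseVar σ)) P := by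
  have hg : HasGaussianLaw (fun ω t => ε t ω) P :=
    IsGaussianProcess.hasGaussianLaw_pi (h.gaussian.comp_right Sum.inr)
  refine iIndepFun.hasLaw_pi (fun t => ?_) (hg.iIndepFun_of_covariance_eq_zero fun s t hst => ?_)
  · refine ⟨(hg.eval t).aemeasurable, ?_⟩
    have h1 : HasGaussianLaw (ε t) P := hg.eval t
    rw [h1.map_eq_gaussianReal, h.mean_noise, ← covariance_self (h.measurable_noise t).aemeasurable,
      h.cov_noise, if_pos rfl]
    congr 1
    exact Real.toNNReal_of_nonneg (sq_nonneg σ)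
  · rw [h.cov_noise, if_neg hst]

/-- The mutual information of noisy observations and the values of a Gaussian process, in terms of
the sequence of posterior variances. -/
theorem mutualInfo_eq (h : IsNoisyGP f ε k σ P) (hk : (Matrix.of k).PosSemidef)
    (hσ : 0 < σ) (a : Fin T → X) :
    mutualInfo P (fun ω i => f (a i) ω + ε i ω) (fun ω i => f (a i) ω) ≠ ∞ ∧
      (mutualInfo P (fun ω i => f (a i) ω + ε i ω) (fun ω i => f (a i) ω)).toReal
        = ∑ t, Real.log (1 + (σ ^ 2)⁻¹ * queryVar k σ (tuplePrefix a t) (a t)) / 2 := by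
  have := h.isProbabilityMeasure
  have hv0 (t : Fin T) := h.queryVar_nonneg hk hσ (tuplePrefix a t) (tuplePrefix_id_injective t) (a t)
  have hpos (t : Fin T) : 0 < queryVar k σ (tuplePrefix a t) (a t) + σ ^ 2 :=
    add_pos_of_nonneg_of_pos (hv0 t) (by positivity)
  have hind : IndepFun (fun ω i => f (a i) ω) (fun ω i => ε i ω) P := by
    have h1 := h.gaussian.indepFun_of_covariance_eq_zero
      (fun x => (h.measurable_f x).aemeasurable) (fun i => (h.measurable_noise i).aemeasurable)
      h.cov_f_noise
    exact h1.comp (φ := fun g i => g (a i)) (by fun_prop) measurable_id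
  have hlaw : HasLaw (fun ω => (innovationMatrix k σ a).mulVec
      ((fun i => f (a i) ω) + fun i => ε i ω)) (Measure.pi fun t => gaussianReal 0
        (queryVar k σ (tuplePrefix a t) (a t) + σ ^ 2).toNNReal) P := by
    refine (h.hasLaw_innovation hk hσ a).congr (Filter.Eventually.of_forall fun ω => ?_)
    funext t
    exact innovationMatrix_mulVec_noisyObs a ω t
  obtain ⟨h1, h2⟩ := mutualInfo_gaussian (measurable_pi_lambda _ fun i => h.measurable_f (a i))
    (measurable_pi_lambda _ h.measurable_noise) hind (det_innovationMatrix k σ a)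
    (fun _ => by
      rw [← NNReal.coe_ne_zero]
      exact (by positivity : (0 : ℝ) < σ ^ 2).ne')
    (fun t => by simpa using hpos t) h.hasLaw_noise hlaw
  refine ⟨h1, h2.trans (Finset.sum_congr rfl fun t _ => ?_)⟩
  rw [Real.coe_toNNReal _ (hpos t).le]
  change (_ - Real.log (σ ^ 2)) / 2 = _
  rw [← Real.log_div (hpos t).ne' (by positivity)]
  congr 2
  field_simp
  ring

end IsNoisyGP

end

/-! ### Posterior variances against the maximum information gain. -/

/-- The posterior variances along any sequence of queries are controlled by the maximum
information gain. -/
theorem sum_log_le_maxInfoGain {X : Type*} [Fintype X] [DecidableEq X] {k : X → X → ℝ} {σ : ℝ}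
    (hk : (Matrix.of k).PosSemidef) (hσ : 0 < σ) {T : ℕ} (a : Fin T → X) :
    ∑ t, Real.log (1 + (σ ^ 2)⁻¹ * queryVar k σ (tuplePrefix a t) (a t)) / 2
      ≤ maxInfoGain k σ T := by
  set G := multivariateGaussian (0 : EuclideanSpace ℝ X) (Matrix.of k) with hG
  set Q := Measure.pi (fun _ : Fin T => gaussianReal 0 (noiseVar σ)) with hQ
  have hcoord : HasGaussianLaw (fun p : EuclideanSpace ℝ X × (Fin T → ℝ) => fun x => p.1 x)
      (G.prod Q) := by
    have h0 : HasGaussianLaw (fun p : EuclideanSpace ℝ X × (Fin T → ℝ) => p.1) (G.prod Q) :=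
      (measurePreserving_fst (μ := G) (ν := Q)).hasLaw.hasGaussianLaw
    exact h0.map_equiv (EuclideanSpace.equiv X ℝ)
  have hGP : IsCenteredGP (fun x (p : EuclideanSpace ℝ X × (Fin T → ℝ)) => p.1 x) k (G.prod Q) := by
    refine ⟨HasGaussianLaw.isGaussianProcess hcoord, fun x => ?_, fun x x' => ?_⟩
    · have h1 := (measurePreserving_eval_multivariateGaussian (μ := (0 : EuclideanSpace ℝ X))
        hk (i := x)).hasLaw.comp (measurePreserving_fst (μ := G) (ν := Q)).hasLaw
      have := h1.integral_eq
      rw [integral_id_gaussianReal] at this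
      simpa using this
    · have h1 := (measurePreserving_fst (μ := G) (ν := Q)).hasLaw.covariance_fun_comp
        (f := fun p => p x) (g := fun p => p x') (by fun_prop) (by fun_prop)
      rw [h1, covariance_eval_multivariateGaussian hk]
      rfl
  have hnoise : HasLaw (fun p : EuclideanSpace ℝ X × (Fin T → ℝ) => fun i => p.2 i) Q (G.prod Q) :=
    (measurePreserving_snd (μ := G) (ν := Q)).hasLaw
  have hlaw (i : Fin T) : HasLaw (fun p : EuclideanSpace ℝ X × (Fin T → ℝ) => p.2 i)
      (gaussianReal 0 (noiseVar σ)) (G.prod Q) :=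
    (measurePreserving_eval (fun _ : Fin T => gaussianReal 0 (noiseVar σ)) i).hasLaw.fun_comp hnoise
  -- The posterior variances depend only on the design, so their logarithmic sum may be computed on
  -- the canonical space that defines `maxInfoGain`.
  have hN : IsNoisyGP (fun x (p : EuclideanSpace ℝ X × (Fin T → ℝ)) => p.1 x) (fun i p => p.2 i)
      k σ (G.prod Q) := by
    refine IsNoisyGP.of_indepFun (fun x => by fun_prop) (fun i => by fun_prop) hGP hlaw
      ((iIndepFun_iff_hasLaw_pi_pi hlaw).2 hnoise) ?_
    have h1 : IndepFun (fun p : EuclideanSpace ℝ X × (Fin T → ℝ) => p.1) (fun p => p.2)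
        (G.prod Q) := indepFun_prod measurable_id measurable_id
    exact h1.comp (φ := fun (v : EuclideanSpace ℝ X) x => v x) (by fun_prop) measurable_id
  rw [← (hN.mutualInfo_eq hk hσ a).2]
  refine ENNReal.toReal_mono ?_ (le_iSup (fun a : Fin T → X => mutualInfo (G.prod Q)
    (fun p i => p.1 (a i) + p.2 i) (fun p i => p.1 (a i))) a)
  have : Nonempty (Fin T → X) := ⟨a⟩
  -- There are finitely many designs, so the supremum is attained and hence finite; otherwise
  -- `toReal` would not be monotone here.
  obtain ⟨b, hb⟩ := exists_eq_ciSup_of_finite (f := fun a : Fin T → X => mutualInfo (G.prod Q)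
    (fun p i => p.1 (a i) + p.2 i) (fun p i => p.1 (a i)))
  rw [← hb]
  exact (hN.mutualInfo_eq hk hσ b).1

/-- Concavity of the logarithm: on `[0, 1]` the map `v ↦ log (1 + c v)` lies above its chord. With
`c = σ⁻²` and variances at most `1`, this yields the constant `C₁`. -/
theorem mul_log_one_add_le {c v : ℝ} (hc : 0 ≤ c) (hv0 : 0 ≤ v) (hv1 : v ≤ 1) :
    v * Real.log (1 + c) ≤ Real.log (1 + c * v) := by
  have h := strictConcaveOn_log_Ioi.concaveOn.2 (Set.mem_Ioi.2 (by linarith : (0 : ℝ) < 1 + c))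
    (Set.mem_Ioi.2 one_pos) hv0 (sub_nonneg.2 hv1) (by ring)
  rw [smul_eq_mul, smul_eq_mul, smul_eq_mul, smul_eq_mul, Real.log_one, mul_zero, add_zero,
    show v * (1 + c) + (1 - v) * 1 = 1 + c * v by ring] at h
  exact h

theorem sum_queryVar_le {X : Type*} [Fintype X] [DecidableEq X] {k : X → X → ℝ} {σ : ℝ}
    (hk : (Matrix.of k).PosSemidef) (hk1 : ∀ x, k x x ≤ 1) (hσ : 0 < σ) {T : ℕ} (a : Fin T → X)
    (h0 : ∀ t, 0 ≤ queryVar k σ (tuplePrefix a t) (a t)) :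
    ∑ t, queryVar k σ (tuplePrefix a t) (a t)
      ≤ 2 / Real.log (1 + (σ ^ 2)⁻¹) * maxInfoGain k σ T := by
  have hlog : 0 < Real.log (1 + (σ ^ 2)⁻¹) := Real.log_pos (by
    have : 0 < (σ ^ 2)⁻¹ := by positivity
    linarith)
  rw [div_mul_eq_mul_div, le_div_iff₀ hlog, Finset.sum_mul]
  have h1 := sum_log_le_maxInfoGain hk hσ a
  rw [← Finset.sum_div, div_le_iff₀ two_pos] at h1
  refine le_trans (Finset.sum_le_sum fun t _ => ?_) (h1.trans_eq (mul_comm _ _))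
  exact mul_log_one_add_le (by positivity) (h0 t) ((queryVar_le hk hσ _ _).trans (hk1 _))

/-! ### Integrals along random choices from a finite set. -/

section FiniteChoice

variable {Ω X : Type*} [MeasurableSpace Ω] [Fintype X] [MeasurableSpace X]
  [DiscreteMeasurableSpace X] {P : Measure Ω}

theorem measurable_eval_choice {p : Ω → X} (hp : Measurable p) {g : X → Ω → ℝ}
    (hg : ∀ x, Measurable (g x)) : Measurable fun ω => g (p ω) ω := by
  have h : Measurable fun q : X × Ω => g q.1 q.2 := measurable_from_prod_countable_right hg
  exact h.comp (hp.prodMk measurable_id)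

theorem integrable_eval_choice {p : Ω → X} (hp : Measurable p) {g : X → Ω → ℝ}
    (hg : ∀ x, Measurable (g x)) (hI : ∀ x, Integrable (g x) P) :
    Integrable (fun ω => g (p ω) ω) P := by
  refine (integrable_finsetSum Finset.univ fun x _ => (hI x).abs).mono
    (measurable_eval_choice hp hg).aestronglyMeasurable (Filter.Eventually.of_forall fun ω => ?_)
  rw [Real.norm_eq_abs, Real.norm_eq_abs]
  exact (Finset.single_le_sum (f := fun x => |g x ω|) (fun _ _ => abs_nonneg _)
    (Finset.mem_univ (p ω))).trans (le_abs_self _)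

/-- Applied with `h` the query history, this takes the place of conditioning on the past. -/
theorem integral_eq_sum_setIntegral_fiber {h : Ω → X} (hh : Measurable h) {F : Ω → ℝ}
    (hF : Integrable F P) : ∫ ω, F ω ∂P = ∑ a, ∫ ω in h ⁻¹' {a}, F ω ∂P := by
  have hm (a : X) : MeasurableSet (h ⁻¹' {a}) := hh (measurableSet_singleton a)
  rw [← integral_iUnion_fintype hm (fun a b hab => Set.disjoint_left.2 fun ω ha hb =>
    hab ((Set.mem_singleton_iff.1 ha).symm.trans (Set.mem_singleton_iff.1 hb)))
    fun a => hF.integrableOn]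
  have : ⋃ a, h ⁻¹' {a} = Set.univ := by
    ext ω
    simp
  rw [this, setIntegral_univ]

/-- A centred random vector has mean zero along a choice of coordinate that is independent of it. -/
theorem setIntegral_eval_choice_eq_zero {𝒲 : Type*} [MeasurableSpace 𝒲] {W : Ω → 𝒲}
    {R : Ω → X → ℝ}
    (hW : Measurable W) (hR : Measurable R) (hRW : IndepFun R W P)
    (hRI : ∀ x, Integrable (fun ω => R ω x) P) (hR0 : ∀ x, ∫ ω, R ω x ∂P = 0)
    {p : 𝒲 → X} (hp : Measurable p) {B : Set 𝒲} (hB : MeasurableSet B) :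
    ∫ ω in W ⁻¹' B, R ω (p (W ω)) ∂P = 0 := by
  have hRx (x : X) : Measurable fun ω => R ω x := (measurable_pi_apply x).comp hR
  have hI : Integrable (fun ω => R ω (p (W ω))) P :=
    integrable_eval_choice (hp.comp hW) hRx hRI
  rw [integral_eq_sum_setIntegral_fiber (hp.comp hW) hI.integrableOn]
  refine Finset.sum_eq_zero fun x _ => ?_
  have hs : MeasurableSet (p ⁻¹' {x}) := hp (measurableSet_singleton x)
  rw [Measure.restrict_restrict ((hp.comp hW) (measurableSet_singleton x))]
  have hset : (p ∘ W) ⁻¹' {x} ∩ W ⁻¹' B = W ⁻¹' (p ⁻¹' {x} ∩ B) := rfl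
  rw [hset, ← integral_indicator (hW (hs.inter hB))]
  -- Where the choice equals `x` the integrand is a fixed coordinate times an indicator depending on
  -- `W`, so independence factors the integral.
  have he : (W ⁻¹' (p ⁻¹' {x} ∩ B)).indicator (fun ω => R ω (p (W ω)))
      = fun ω => R ω x * (p ⁻¹' {x} ∩ B).indicator 1 (W ω) := by
    funext ω
    by_cases hω : W ω ∈ p ⁻¹' {x} ∩ B
    · rw [Set.indicator_of_mem (by exact hω), Set.indicator_of_mem hω,
        Set.mem_singleton_iff.1 hω.1]
      simp
    · rw [Set.indicator_of_notMem (by exact hω), Set.indicator_of_notMem hω, mul_zero]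
  have hind : IndepFun (fun ω => R ω x)
      (fun ω => (p ⁻¹' {x} ∩ B).indicator (1 : 𝒲 → ℝ) (W ω)) P :=
    hRW.comp (measurable_pi_apply x) (measurable_one.indicator (hs.inter hB))
  rw [he, hind.integral_fun_mul_eq_mul_integral (hRx x).aestronglyMeasurable
    ((measurable_one.indicator (hs.inter hB)).comp hW).aestronglyMeasurable, hR0, zero_mul]

end FiniteChoice

theorem integrable_sqrt {Ω : Type*} [MeasurableSpace Ω] {P : Measure Ω} [IsProbabilityMeasure P]
    {Z : Ω → ℝ} (hZ : Integrable Z P) : Integrable (fun ω => √(Z ω)) P := by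
  refine ((integrable_const 1).add hZ.abs).mono
    (Real.continuous_sqrt.measurable.comp_aemeasurable
      hZ.aestronglyMeasurable.aemeasurable).aestronglyMeasurable
    (Filter.Eventually.of_forall fun ω => ?_)
  rw [Real.norm_of_nonneg (Real.sqrt_nonneg _)]
  refine le_trans ?_ (le_abs_self _)
  rw [Pi.add_apply, Real.sqrt_le_left (by positivity)]
  nlinarith [le_abs_self (Z ω), abs_nonneg (Z ω)]

/-! ### One round with a frozen past. -/

section Round

variable {Ω X 𝒱 : Type*} [MeasurableSpace Ω] [MeasurableSpace 𝒱] [Fintype X] [Nonempty X]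
  {P : Measure Ω} [IsProbabilityMeasure P]
  {V : Ω → 𝒱} {R : Ω → X → ℝ} {Z : Ω → ℝ} {v : X → ℝ≥0} {M : 𝒱 → X → ℝ} {A : Set 𝒱}

/-- `V` is independent of `R` and of `Z`, so by Fubini each side is an average over frozen values
`w` of `V`, and for each `w` in `A` the domination `integral_maxOver_le` applies with mean vector `M
w`. -/
theorem setIntegral_maxOver_le (hX : 2 ≤ Fintype.card X) (hV : Measurable V) (hR : Measurable R)
    (hZ : Measurable Z) (hVR : IndepFun V R P) (hVZ : IndepFun V Z P)
    (hRl : ∀ x, HasLaw (fun ω => R ω x) (gaussianReal 0 (v x)) P)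
    (hZl : HasLaw Z (shiftedExpMeasure (2 * Real.log ((Fintype.card X : ℝ) / 2)) (1 / 2)) P)
    (hM : Measurable M) (hA : MeasurableSet A)
    (hI₁ : Integrable (fun ω => maxOver fun x => M (V ω) x + R ω x) P)
    (hI₂ : Integrable (fun ω => maxOver fun x => M (V ω) x + √(Z ω) * √(v x)) P) :
    ∫ ω in V ⁻¹' A, maxOver (fun x => M (V ω) x + R ω x) ∂P
      ≤ ∫ ω in V ⁻¹' A, maxOver (fun x => M (V ω) x + √(Z ω) * √(v x)) ∂P := by
  have := Measure.isProbabilityMeasure_map (μ := P) hV.aemeasurable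
  have := Measure.isProbabilityMeasure_map (μ := P) hR.aemeasurable
  have := Measure.isProbabilityMeasure_map (μ := P) hZ.aemeasurable
  have hMx (x : X) : Measurable fun w => M w x := (measurable_pi_apply x).comp hM
  let φ : 𝒱 × (X → ℝ) → ℝ := (Prod.fst ⁻¹' A).indicator
    fun p => maxOver fun x => M p.1 x + p.2 x
  let ψ : 𝒱 × ℝ → ℝ := (Prod.fst ⁻¹' A).indicator
    fun p => maxOver fun x => M p.1 x + √p.2 * √(v x)
  have hφ : Measurable φ := by
    refine (measurable_maxOver.comp (measurable_pi_lambda _ fun x => ?_)).indicator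
      (measurable_fst hA)
    exact ((hMx x).comp measurable_fst).add ((measurable_pi_apply x).comp measurable_snd)
  have hψ : Measurable ψ := by
    refine (measurable_maxOver.comp (measurable_pi_lambda _ fun x => ?_)).indicator
      (measurable_fst hA)
    exact ((hMx x).comp measurable_fst).add
      ((Real.continuous_sqrt.measurable.comp measurable_snd).mul_const _)
  have hφe : (fun ω => φ (V ω, R ω))
      = (V ⁻¹' A).indicator fun ω => maxOver fun x => M (V ω) x + R ω x := by
    funext ω
    simp only [φ]
    rfl
  have hψe : (fun ω => ψ (V ω, Z ω))
      = (V ⁻¹' A).indicator fun ω => maxOver fun x => M (V ω) x + √(Z ω) * √(v x) := by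
    funext ω
    simp only [ψ]
    rfl
  have hpR := (indepFun_iff_map_prod_eq_prod_map_map hV.aemeasurable hR.aemeasurable).1 hVR
  have hpZ := (indepFun_iff_map_prod_eq_prod_map_map hV.aemeasurable hZ.aemeasurable).1 hVZ
  have hφI : Integrable φ ((P.map V).prod (P.map R)) := by
    rw [← hpR, integrable_map_measure hφ.aestronglyMeasurable (hV.prodMk hR).aemeasurable]
    change Integrable (fun ω => φ (V ω, R ω)) P
    rw [hφe]
    exact hI₁.indicator (hV hA)
  have hψI : Integrable ψ ((P.map V).prod (P.map Z)) := by
    rw [← hpZ, integrable_map_measure hψ.aestronglyMeasurable (hV.prodMk hZ).aemeasurable]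
    change Integrable (fun ω => ψ (V ω, Z ω)) P
    rw [hψe]
    exact hI₂.indicator (hV hA)
  have h1 : ∫ ω in V ⁻¹' A, maxOver (fun x => M (V ω) x + R ω x) ∂P
      = ∫ w, ∫ r, φ (w, r) ∂P.map R ∂P.map V := by
    rw [← integral_prod φ hφI, ← hpR, integral_map (hV.prodMk hR).aemeasurable
      hφ.aestronglyMeasurable, hφe, integral_indicator (hV hA)]
  have h2 : ∫ ω in V ⁻¹' A, maxOver (fun x => M (V ω) x + √(Z ω) * √(v x)) ∂P
      = ∫ w, ∫ z, ψ (w, z) ∂P.map Z ∂P.map V := by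
    rw [← integral_prod ψ hψI, ← hpZ, integral_map (hV.prodMk hZ).aemeasurable
      hψ.aestronglyMeasurable, hψe, integral_indicator (hV hA)]
  rw [h1, h2]
  refine integral_mono hφI.integral_prod_left hψI.integral_prod_left fun w => ?_
  by_cases hw : w ∈ A
  · have e1 (r : X → ℝ) : φ (w, r) = maxOver fun x => M w x + r x :=
      Set.indicator_of_mem (s := Prod.fst ⁻¹' A) hw _
    have e2 (z : ℝ) : ψ (w, z) = maxOver fun x => M w x + √z * √(v x) :=
      Set.indicator_of_mem (s := Prod.fst ⁻¹' A) hw _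
    simp only [e1, e2]
    rw [hZl.map_eq]
    refine integral_maxOver_le hX (fun x => ⟨(measurable_pi_apply x).aemeasurable, ?_⟩) (M w)
    rw [Measure.map_map (by fun_prop) hR]
    exact (hRl x).map_eq
  · have e1 (r : X → ℝ) : φ (w, r) = 0 := Set.indicator_of_notMem (s := Prod.fst ⁻¹' A) hw _
    have e2 (z : ℝ) : ψ (w, z) = 0 := Set.indicator_of_notMem (s := Prod.fst ⁻¹' A) hw _
    simp only [e1, e2, integral_zero, le_refl]

variable [MeasurableSpace X] [DiscreteMeasurableSpace X]

/-- The expected instantaneous regret, on an event of the past, is at most the expected width of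
the confidence interval. -/
theorem setIntegral_regret_le (hX : 2 ≤ Fintype.card X) (hV : Measurable V) (hR : Measurable R)
    (hZ : Measurable Z) (hRW : IndepFun R (fun ω => (V ω, Z ω)) P) (hVZ : IndepFun V Z P)
    (hRl : ∀ x, HasLaw (fun ω => R ω x) (gaussianReal 0 (v x)) P)
    (hZl : HasLaw Z (shiftedExpMeasure (2 * Real.log ((Fintype.card X : ℝ) / 2)) (1 / 2)) P)
    (hZI : Integrable Z P) (hM : Measurable M) (hMI : ∀ x, Integrable (fun ω => M (V ω) x) P)
    (hA : MeasurableSet A) {p : 𝒱 × ℝ → X} (hp : Measurable p)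
    (hmax : ∀ w z x, M w x + √z * √(v x) ≤ M w (p (w, z)) + √z * √(v (p (w, z)))) :
    ∫ ω in V ⁻¹' A, (maxOver (fun x => M (V ω) x + R ω x)
        - (M (V ω) (p (V ω, Z ω)) + R ω (p (V ω, Z ω)))) ∂P
      ≤ ∫ ω in V ⁻¹' A, √(Z ω) * √(v (p (V ω, Z ω))) ∂P := by
  have hW : Measurable fun ω => (V ω, Z ω) := hV.prodMk hZ
  have hpW : Measurable fun ω => p (V ω, Z ω) := hp.comp hW
  have hRx (x : X) : Measurable fun ω => R ω x := (measurable_pi_apply x).comp hR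
  have hMx (x : X) : Measurable fun ω => M (V ω) x := (measurable_pi_apply x).comp (hM.comp hV)
  have hRI (x : X) : Integrable (fun ω => R ω x) P := (hRl x).hasGaussianLaw.integrable
  have hR0 (x : X) : ∫ ω, R ω x ∂P = 0 := by
    rw [(hRl x).integral_eq, integral_id_gaussianReal]
  have hsI (x : X) : Integrable (fun ω => √(Z ω) * √(v x : ℝ)) P := (integrable_sqrt hZI).mul_const _
  have hsm (x : X) : Measurable fun ω => √(Z ω) * √(v x : ℝ) :=
    (Real.continuous_sqrt.measurable.comp hZ).mul_const _
  have hI₁ : Integrable (fun ω => maxOver fun x => M (V ω) x + R ω x) P :=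
    Integrable.maxOver_comp (g := fun x ω => M (V ω) x + R ω x) fun x => (hMI x).add (hRI x)
  have hI₂ : Integrable (fun ω => maxOver fun x => M (V ω) x + √(Z ω) * √(v x)) P :=
    Integrable.maxOver_comp (g := fun x ω => M (V ω) x + √(Z ω) * √(v x))
      fun x => (hMI x).add (hsI x)
  have hMp : Integrable (fun ω => M (V ω) (p (V ω, Z ω))) P :=
    integrable_eval_choice (g := fun x ω => M (V ω) x) hpW hMx hMI
  have hRp : Integrable (fun ω => R ω (p (V ω, Z ω))) P :=
    integrable_eval_choice (g := fun x ω => R ω x) hpW hRx hRI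
  have hsp : Integrable (fun ω => √(Z ω) * √(v (p (V ω, Z ω)) : ℝ)) P :=
    integrable_eval_choice (g := fun x ω => √(Z ω) * √(v x : ℝ)) hpW hsm hsI
  have h1 := setIntegral_maxOver_le hX hV hR hZ
    (hRW.comp measurable_id measurable_fst).symm hVZ hRl hZl hM hA hI₁ hI₂
  -- The choice attains the largest confidence bound, so the dominating maximum splits into
  -- posterior mean and width at the chosen point.
  have h2 : ∫ ω in V ⁻¹' A, maxOver (fun x => M (V ω) x + √(Z ω) * √(v x)) ∂P
      = ∫ ω in V ⁻¹' A, M (V ω) (p (V ω, Z ω)) ∂P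
        + ∫ ω in V ⁻¹' A, √(Z ω) * √(v (p (V ω, Z ω))) ∂P := by
    rw [← integral_add hMp.integrableOn hsp.integrableOn]
    congr 1
    funext ω
    exact maxOver_eq (g := fun x => M (V ω) x + √(Z ω) * √(v x)) (hmax (V ω) (Z ω))
  -- The choice is a function of `(V, Z)`, of which the centred residual is independent.
  have h3 : ∫ ω in V ⁻¹' A, R ω (p (V ω, Z ω)) ∂P = 0 :=
    setIntegral_eval_choice_eq_zero hW hR hRW hRI hR0 hp (B := Prod.fst ⁻¹' A) (measurable_fst hA)
  have hMRp : Integrable (fun ω => M (V ω) (p (V ω, Z ω)) + R ω (p (V ω, Z ω))) P := hMp.add hRp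
  rw [integral_sub hI₁.integrableOn hMRp.integrableOn,
    integral_add hMp.integrableOn hRp.integrableOn, h3]
  linarith

end Round

/-! ### Expected regret of a round of the adaptive algorithm. -/

section Algorithm

variable {Ω X S : Type*}
  {f : X → Ω → ℝ} {ε ζ : ℕ → Ω → ℝ} {ξ : Ω → S} {k : X → X → ℝ} {σ : ℝ}
  {pick : (n : ℕ) → (Fin n → X × ℝ) → ℝ → S → X} {x : ℕ → Ω → X} {y : ℕ → Ω → ℝ}

/-- The queries of the first `t` rounds are equal to `a` if and only if the rule picks `a` on the
data that would be observed by querying `a`. -/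
theorem queries_eq_iff
    (hx : ∀ t ω, x t ω = pick t (fun i : Fin t => (x i ω, y i ω)) (ζ t ω) (ξ ω))
    (hy : ∀ t ω, y t ω = f (x t ω) ω + ε t ω) {t : ℕ} (a : Fin t → X) (ω : Ω) :
    (fun i : Fin t => x i ω) = a ↔ ∀ i : Fin t,
      pick i (fun j : Fin i => (tuplePrefix a i j,
        tuplePrefix (fun j : Fin t => noisyObs f (fun i : Fin t => ε i) a id j ω) i j))
        (ζ i ω) (ξ ω) = a i := by
  have hstep (i : Fin t) (h : ∀ j : Fin i, x j ω = tuplePrefix a i j) :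
      x i ω = pick i (fun j : Fin i => (tuplePrefix a i j,
        tuplePrefix (fun j : Fin t => noisyObs f (fun i : Fin t => ε i) a id j ω) i j))
        (ζ i ω) (ξ ω) := by
    rw [hx]
    congr 1
    funext j
    rw [hy, h j]
    rfl
  constructor
  · intro h i
    rw [← hstep i fun j => congrFun h (Fin.castLE i.is_lt.le j)]
    exact congrFun h i
  · intro h
    -- Strong induction: once the earlier queries agree with `a`, the actual data agree with those
    -- of the frozen design, and so does the next pick.
    have key : ∀ n (hn : n < t), x n ω = a ⟨n, hn⟩ := by
      intro n
      induction n using Nat.strong_induction_on with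
      | _ n ih =>
        intro hn
        rw [← h ⟨n, hn⟩]
        exact hstep ⟨n, hn⟩ fun j => ih j j.is_lt (j.is_lt.trans hn)
    funext i
    exact key i i.is_lt

variable [MeasurableSpace Ω] [MeasurableSpace X] [MeasurableSpace S]

theorem measurable_query_obs [Fintype X] [DiscreteMeasurableSpace X]
    (hfm : ∀ x, Measurable (f x)) (hεm : ∀ t, Measurable (ε t))
    (hζm : ∀ t, Measurable (ζ t)) (hξm : Measurable ξ) (hpick : IsUCBRule k σ pick)
    (hx : ∀ t ω, x t ω = pick t (fun i : Fin t => (x i ω, y i ω)) (ζ t ω) (ξ ω))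
    (hy : ∀ t ω, y t ω = f (x t ω) ω + ε t ω) (t : ℕ) : Measurable (x t) ∧ Measurable (y t) := by
  induction t using Nat.strong_induction_on with
  | _ t ih =>
    have h1 : Measurable (x t) := by
      have h2 : x t = fun ω => pick t (fun i : Fin t => (x i ω, y i ω)) (ζ t ω) (ξ ω) :=
        funext (hx t)
      rw [h2]
      exact (hpick.measurable_pick t).comp ((measurable_pi_lambda _ fun i : Fin t =>
        (ih i i.is_lt).1.prodMk (ih i i.is_lt).2).prodMk ((hζm t).prodMk hξm))
    refine ⟨h1, ?_⟩
    have h3 : y t = fun ω => f (x t ω) ω + ε t ω := funext (hy t)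
    rw [h3]
    exact (measurable_eval_choice h1 hfm).add (hεm t)

theorem indepFun_iid_prefix {P : Measure Ω} (hζm : ∀ t, Measurable (ζ t)) (hζi : iIndepFun ζ P)
    (t : ℕ) : IndepFun (ζ t) (fun ω (i : Fin t) => ζ i ω) P := by
  have h := hζi.indepFun_finset {t} (Finset.range t) (by simp) hζm
  exact h.comp (φ := fun g : ({t} : Finset ℕ) → ℝ => g ⟨t, by simp⟩)
    (ψ := fun g : (Finset.range t) → ℝ => fun i : Fin t => g ⟨i, by simp⟩)
    (by fun_prop) (by fun_prop)

/-- The expected regret of a round is at most the expected width of the confidence interval. -/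
theorem integral_regret_le [Fintype X] [DiscreteMeasurableSpace X] [Nonempty X] {P : Measure Ω}
    [IsProbabilityMeasure P] (hX : 2 ≤ Fintype.card X)
    (hk : (Matrix.of k).PosSemidef) (hσ : 0 < σ)
    (hfm : ∀ x, Measurable (f x)) (hεm : ∀ t, Measurable (ε t))
    (hζm : ∀ t, Measurable (ζ t)) (hξm : Measurable ξ)
    (hN : ∀ t, IsNoisyGP f (fun i : Fin t => ε i) k σ P)
    (hζ : ∀ t, HasLaw (ζ t)
      (shiftedExpMeasure (2 * Real.log ((Fintype.card X : ℝ) / 2)) (1 / 2)) P)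
    (hζI : ∀ t, Integrable (ζ t) P) (hζi : iIndepFun ζ P)
    (hind : IndepFun (fun ω => (fun x => f x ω, fun t => ε t ω)) (fun ω => (fun t => ζ t ω, ξ ω)) P)
    (hind₃ : IndepFun (fun ω t => ζ t ω) ξ P)
    (hpick : IsUCBRule k σ pick)
    (hx : ∀ t ω, x t ω = pick t (fun i : Fin t => (x i ω, y i ω)) (ζ t ω) (ξ ω))
    (hy : ∀ t ω, y t ω = f (x t ω) ω + ε t ω) (t : ℕ) :
    ∫ ω, (maxOver (fun z => f z ω) - f (x t ω) ω) ∂P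
      ≤ ∫ ω, √(ζ t ω) * √(queryVar k σ (fun i : Fin t => x i ω) (x t ω)) ∂P := by
  have hxy := measurable_query_obs hfm hεm hζm hξm hpick hx hy
  have hxm : Measurable fun ω => fun i : Fin t => x i ω := measurable_pi_lambda _ fun i => (hxy i).1
  have hfI := (hN t).integrable_f
  have hF : Integrable (fun ω => maxOver (fun z => f z ω) - f (x t ω) ω) P :=
    (Integrable.maxOver_comp hfI).sub (integrable_eval_choice (hxy t).1 hfm hfI)
  have hG : Integrable
      (fun ω => √(ζ t ω) * √(queryVar k σ (fun i : Fin t => x i ω) (x t ω))) P :=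
    integrable_eval_choice (hxm.prodMk (hxy t).1)
      (g := fun (q : (Fin t → X) × X) ω => √(ζ t ω) * √(queryVar k σ q.1 q.2))
      (fun q => (Real.continuous_sqrt.measurable.comp (hζm t)).mul_const _)
      fun q => (integrable_sqrt (hζI t)).mul_const _
  -- From here on the history is a fixed tuple `a`, which removes the adaptivity of the design.
  rw [integral_eq_sum_setIntegral_fiber hxm hF, integral_eq_sum_setIntegral_fiber hxm hG]
  refine Finset.sum_le_sum fun a _ => ?_
  -- `Y` holds the observations that the design `a` would give on all of `Ω`. They are Gaussian,
  -- unlike the actual data, and agree with the actual data where the history is `a`.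
  set Y : Ω → Fin t → ℝ := fun ω i => noisyObs f (fun i : Fin t => ε i) a id i ω with hYdef
  set R : Ω → X → ℝ := fun ω z => postResidual f (fun i : Fin t => ε i) k σ a id z ω with hRdef
  -- `V` gathers all that determines whether the history is `a`: observations, past confidence
  -- parameters and the seed.
  let V : Ω → (Fin t → ℝ) × (Fin t → ℝ) × S := fun ω => (Y ω, fun i : Fin t => ζ i ω, ξ ω)
  let M : (Fin t → ℝ) × (Fin t → ℝ) × S → X → ℝ := fun w z => ∑ i, postWeights k σ a z i * w.1 i
  let A : Set ((Fin t → ℝ) × (Fin t → ℝ) × S) := {w | ∀ i : Fin t,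
    pick i (fun j : Fin i => (tuplePrefix a i j, tuplePrefix w.1 i j)) (w.2.1 i) w.2.2 = a i}
  let p : ((Fin t → ℝ) × (Fin t → ℝ) × S) × ℝ → X := fun w =>
    pick t (fun i => (a i, w.1.1 i)) w.2 w.1.2.2
  have hYm : Measurable Y := measurable_pi_lambda _ fun i => (hN t).measurable_noisyObs a id i
  have hRm : Measurable R := measurable_pi_lambda _ fun z => (hN t).measurable_residual a id z
  have hζpm : Measurable fun ω => fun i : Fin t => ζ i ω := measurable_pi_lambda _ fun i => hζm i
  have hVm : Measurable V := hYm.prodMk (hζpm.prodMk hξm)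
  have hAset : (fun ω => fun i : Fin t => x i ω) ⁻¹' {a} = V ⁻¹' A := by
    ext ω
    exact queries_eq_iff hx hy a ω
  have hAm : MeasurableSet A := by
    have : A = ⋂ i : Fin t, {w | pick i (fun j : Fin i =>
        (tuplePrefix a i j, tuplePrefix w.1 i j)) (w.2.1 i) w.2.2 = a i} := by
      ext w
      simp [A]
    rw [this]
    refine MeasurableSet.iInter fun i => ?_
    have h1 : Measurable fun w : (Fin t → ℝ) × (Fin t → ℝ) × S => pick i (fun j : Fin i =>
        (tuplePrefix a i j, tuplePrefix w.1 i j)) (w.2.1 i) w.2.2 := by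
      refine (hpick.measurable_pick i).comp (Measurable.prodMk ?_ (Measurable.prodMk ?_ ?_))
      · refine measurable_pi_lambda _ fun j => measurable_const.prodMk ?_
        exact (measurable_pi_apply _).comp measurable_fst
      · exact (measurable_pi_apply i).comp (measurable_fst.comp measurable_snd)
      · exact measurable_snd.comp measurable_snd
    exact h1 (measurableSet_singleton (a i))
  have hpm : Measurable p := by
    refine (hpick.measurable_pick t).comp (Measurable.prodMk ?_ (Measurable.prodMk ?_ ?_))
    · refine measurable_pi_lambda _ fun j => measurable_const.prodMk ?_
      exact (measurable_pi_apply j).comp (measurable_fst.comp measurable_fst)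
    · exact measurable_snd
    · exact measurable_snd.comp (measurable_snd.comp measurable_fst)
  have hMm : Measurable M := measurable_pi_lambda _ fun z => Finset.measurable_fun_sum _ fun i _ =>
    ((measurable_pi_apply i).comp measurable_fst).const_mul _
  have hfe (ω : Ω) (z : X) : f z ω = M (V ω) z + R ω z := by
    simp only [M, V, hRdef, hYdef, postResidual]
    ring
  have hxe (ω : Ω) (hω : ω ∈ V ⁻¹' A) : x t ω = p (V ω, ζ t ω) := by
    rw [← hAset] at hω
    have h1 : (fun i : Fin t => x i ω) = a := hω
    rw [hx]
    simp only [p, V]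
    congr 1
    funext i
    rw [hy, show x i ω = a i from congrFun h1 i]
    rfl
  have hfε : Measurable fun ω => (fun x => f x ω, fun t => ε t ω) :=
    (measurable_pi_lambda _ hfm).prodMk (measurable_pi_lambda _ hεm)
  have hζξ : Measurable fun ω => (fun t => ζ t ω, ξ ω) := (measurable_pi_lambda _ hζm).prodMk hξm
  have hYfε : ∃ ψ : (X → ℝ) × (ℕ → ℝ) → (Fin t → ℝ), Measurable ψ ∧
      ∀ ω, Y ω = ψ (fun x => f x ω, fun t => ε t ω) :=
    ⟨fun q i => q.1 (a i) + q.2 i, by fun_prop, fun ω => rfl⟩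
  obtain ⟨ψ, hψ, hYψ⟩ := hYfε
  have hRfε : ∃ χ : (X → ℝ) × (ℕ → ℝ) → (X → ℝ), Measurable χ ∧
      ∀ ω, R ω = χ (fun x => f x ω, fun t => ε t ω) :=
    ⟨fun q z => q.1 z - ∑ i, postWeights k σ a z i * (q.1 (a i) + q.2 i), by fun_prop, fun ω => rfl⟩
  obtain ⟨χ, hχ, hRχ⟩ := hRfε
  -- `R` is independent of `Y` by Gaussianity, and the pair `(R, Y)`, a function of `f` and the
  -- noise, is independent of all the external randomness.
  have hRW : IndepFun R (fun ω => (V ω, ζ t ω)) P := by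
    have h1 : IndepFun R Y P := (hN t).indepFun_residual_noisyObs hk hσ a Function.injective_id
    have h2 : IndepFun (fun ω => (R ω, Y ω)) (fun ω => (fun t => ζ t ω, ξ ω)) P := by
      have := hind.comp (hχ.prodMk hψ) measurable_id
      refine this.congr (Filter.Eventually.of_forall fun ω => ?_) (ae_eq_refl _)
      simp only [Function.comp, hRχ ω, hYψ ω]
    have h3 := indepFun_prodMk_of_indepFun hRm hYm hζξ h1 h2
    exact h3.comp (ψ := fun q : (Fin t → ℝ) × (ℕ → ℝ) × S =>
      ((q.1, fun i : Fin t => q.2.1 i, q.2.2), q.2.1 t)) measurable_id (by fun_prop)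
  have hVZ : IndepFun V (ζ t) P := by
    have h1 : IndepFun (fun ω => (ζ t ω, fun i : Fin t => ζ i ω)) ξ P :=
      hind₃.comp (φ := fun g : ℕ → ℝ => (g t, fun i : Fin t => g i)) (by fun_prop) measurable_id
    have h2 := indepFun_prodMk_of_indepFun (hζm t) hζpm hξm (indepFun_iid_prefix hζm hζi t) h1
    have h3 : IndepFun (fun ω => (ζ t ω, (fun i : Fin t => ζ i ω, ξ ω))) Y P := by
      have := hind.symm.comp (φ := fun g : (ℕ → ℝ) × S => (g.1 t, (fun i : Fin t => g.1 i, g.2)))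
        (by fun_prop) hψ
      refine this.congr (ae_eq_refl _) (Filter.Eventually.of_forall fun ω => ?_)
      simp only [Function.comp, hYψ ω]
    have h4 := indepFun_prodMk_of_indepFun (hζm t) (hζpm.prodMk hξm) hYm h2 h3
    exact (h4.comp measurable_id (measurable_snd.prodMk measurable_fst)).symm
  have hv0 (z : X) : 0 ≤ queryVar k σ a z :=
    (hN t).queryVar_nonneg hk hσ a (e := id) Function.injective_id z
  have hmax (w : (Fin t → ℝ) × (Fin t → ℝ) × S) (s : ℝ) (z : X) :
      M w z + √s * √((queryVar k σ a z).toNNReal : ℝ)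
        ≤ M w (p (w, s)) + √s * √((queryVar k σ a (p (w, s))).toNNReal : ℝ) := by
    have h1 := hpick.le_ucb_pick t (fun i => (a i, w.1 i)) s w.2.2 z
    simp only [ucb, postMean_eq_sum hk] at h1
    rw [Real.coe_toNNReal _ (hv0 _), Real.coe_toNNReal _ (hv0 _)]
    exact h1
  have hMI (z : X) : Integrable (fun ω => M (V ω) z) P :=
    ((hN t).memLp_sum_noisyObs a id (postWeights k σ a z)).integrable (by norm_num)
  have main := setIntegral_regret_le hX hVm hRm (hζm t) hRW hVZ
    (fun z => (hN t).hasLaw_residual hk hσ a Function.injective_id z) (hζ t) (hζI t) hMm hMI hAm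
    hpm hmax
  rw [hAset]
  refine le_of_eq_of_le (setIntegral_congr_fun (hVm hAm) fun ω hω => ?_) (main.trans_eq
    (setIntegral_congr_fun (hVm hAm) fun ω hω => ?_))
  · simp only [hfe, hxe ω hω]
  · simp only [← hxe ω hω]
    rw [Real.coe_toNNReal _ (hv0 _)]
    rw [← hAset] at hω
    have h1 : (fun i : Fin t => x i ω) = a := hω
    rw [h1]

end Algorithm

/-! ### From expected regret to the high-probability bound. -/

/-- Jensen's inequality, read off from the nonnegativity of the variance of `√Z`. -/
theorem integral_sqrt_le {Ω : Type*} [MeasurableSpace Ω] {P : Measure Ω} [IsProbabilityMeasure P]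
    {Z : Ω → ℝ} (hZ : Integrable Z P) (h0 : 0 ≤ᵐ[P] Z) : ∫ ω, √(Z ω) ∂P ≤ √(∫ ω, Z ω ∂P) := by
  have hI := integrable_sqrt hZ
  have hsq : (fun ω => √(Z ω) ^ 2) =ᵐ[P] Z := h0.mono fun ω hω => Real.sq_sqrt hω
  have hL : MemLp (fun ω => √(Z ω)) 2 P :=
    (memLp_two_iff_integrable_sq hI.aestronglyMeasurable).2 ((integrable_congr hsq).2 hZ)
  have h1 := variance_eq_sub hL
  have h2 := variance_nonneg (fun ω => √(Z ω)) P
  have h3 : ∫ ω, ((fun ω => √(Z ω)) ^ 2) ω ∂P = ∫ ω, Z ω ∂P := integral_congr_ae hsq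
  rw [h1, h3] at h2
  exact Real.le_sqrt_of_sq_le (by linarith)

theorem one_sub_le_measureReal_of_integral_le {Ω : Type*} [MeasurableSpace Ω] {P : Measure Ω}
    [IsProbabilityMeasure P] {R : Ω → ℝ} (hR : Measurable R) (hI : Integrable R P)
    (h0 : ∀ ω, 0 ≤ R ω) {B δ : ℝ} (hB : 0 ≤ B) (hRB : ∫ ω, R ω ∂P ≤ B) (hδ : 0 < δ) :
    1 - δ ≤ P.real {ω | R ω ≤ B / δ} := by
  have hms : MeasurableSet {ω | R ω ≤ B / δ} := hR measurableSet_Iic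
  -- For `B = 0` the threshold in Markov's inequality is zero and gives nothing; instead `R`
  -- vanishes almost surely.
  rcases hB.eq_or_lt with hB0 | hB0
  · have h1 : R =ᵐ[P] 0 := (integral_eq_zero_iff_of_nonneg h0 hI).1
      (le_antisymm (hRB.trans hB0.symm.le) (integral_nonneg h0))
    have h2 : ∀ᵐ ω ∂P, ω ∈ {ω | R ω ≤ B / δ} := by
      filter_upwards [h1] with ω hω
      change R ω ≤ B / δ
      rw [hω]
      positivity
    rw [measureReal_def, (mem_ae_iff_prob_eq_one hms).1 h2]
    simp [hδ.le]
  · have h1 := mul_meas_ge_le_integral_of_nonneg (Filter.Eventually.of_forall h0) hI (B / δ)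
    have h2 : P.real {ω | R ω ≤ B / δ}ᶜ ≤ P.real {ω | B / δ ≤ R ω} := by
      refine measureReal_mono fun ω hω => ?_
      simp only [Set.mem_compl_iff, Set.mem_ofPred_eq, not_le] at hω ⊢
      exact hω.le
    rw [probReal_compl_eq_one_sub hms] at h2
    have h3 : B / δ * P.real {ω | B / δ ≤ R ω} ≤ B / δ * δ := by
      rw [div_mul_cancel₀ _ hδ.ne']
      exact h1.trans hRB
    have h4 := le_of_mul_le_mul_left h3 (by positivity)
    linarith

theorem mainTheorem10
    {Ω X S : Type*} [MeasurableSpace Ω] (P : Measure Ω) [IsProbabilityMeasure P]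
    [Fintype X] [DecidableEq X] [MeasurableSpace X] [DiscreteMeasurableSpace X]
    [MeasurableSpace S]
    -- the kernel and the noise level
    (k : X → X → ℝ) (hk : (Matrix.of k).PosSemidef) (hk1 : ∀ x, k x x ≤ 1)
    (σ : ℝ) (hσ : 0 < σ)
    -- objective, noise, confidence parameters, seed for breaking ties
    (f : X → Ω → ℝ) (ε : ℕ → Ω → ℝ) (ζ : ℕ → Ω → ℝ) (ξ : Ω → S)
    (hfm : ∀ x, Measurable (f x)) (hεm : ∀ t, Measurable (ε t))
    (hζm : ∀ t, Measurable (ζ t)) (hξm : Measurable ξ)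
    (hf : IsCenteredGP f k P)
    (hε : ∀ t, HasLaw (ε t) (gaussianReal 0 (noiseVar σ)) P) (hεi : iIndepFun ε P)
    (hζ : ∀ t, HasLaw (ζ t)
      (shiftedExpMeasure (2 * Real.log ((Fintype.card X : ℝ) / 2)) (1 / 2)) P)
    (hζi : iIndepFun ζ P)
    -- `f`, `(ε t)`, `(ζ t)` and `ξ` are mutually independent
    (hind₁ : IndepFun (fun ω x => f x ω) (fun ω => (fun t => ε t ω, fun t => ζ t ω, ξ ω)) P)
    (hind₂ : IndepFun (fun ω t => ε t ω) (fun ω => (fun t => ζ t ω, ξ ω)) P)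
    (hind₃ : IndepFun (fun ω t => ζ t ω) ξ P)
    -- running the algorithm; index `t` stands for round `t + 1`
    (pick : (n : ℕ) → (Fin n → X × ℝ) → ℝ → S → X) (hpick : IsUCBRule k σ pick)
    (x : ℕ → Ω → X) (y : ℕ → Ω → ℝ)
    (hx : ∀ t ω, x t ω = pick t (fun i : Fin t => (x i ω, y i ω)) (ζ t ω) (ξ ω))
    (hy : ∀ t ω, y t ω = f (x t ω) ω + ε t ω)
    -- a maximiser of the objective
    (xstar : Ω → X) (hxstar : ∀ ω z, f z ω ≤ f (xstar ω) ω)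
    (T : ℕ) (hT : 1 ≤ T) (δ : ℝ) (hδ0 : 0 < δ) (hδ1 : δ < 1) :
    let C₁ : ℝ := 2 / Real.log (1 + (σ ^ 2)⁻¹)
    let C₂ : ℝ := 2 + 2 * Real.log ((Fintype.card X : ℝ) / 2)
    1 - δ ≤ P.real {ω | cumRegret (fun z => f z ω) (xstar ω) (fun t => x t ω) T
      ≤ √(C₁ * C₂ * T * maxInfoGain k σ T) / δ} := by
  intro C₁ C₂
  have hΩ : Nonempty Ω := P.nonempty_of_neZero
  have hXne : Nonempty X := hΩ.map xstar
  have hcum (ω : Ω) : cumRegret (fun z => f z ω) (xstar ω) (fun t => x t ω) T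
      = ∑ t ∈ Finset.range T, (maxOver (fun z => f z ω) - f (x t ω) ω) := by
    rw [cumRegret, maxOver_eq (g := fun z => f z ω) (hxstar ω)]
  simp only [hcum]
  have hr0 (t : ℕ) (ω : Ω) : 0 ≤ maxOver (fun z => f z ω) - f (x t ω) ω :=
    sub_nonneg.2 (le_maxOver (fun z => f z ω) (x t ω))
  have hxy := measurable_query_obs hfm hεm hζm hξm hpick hx hy
  have hmax : Measurable fun ω => maxOver fun z => f z ω :=
    measurable_maxOver.comp (measurable_pi_lambda _ hfm)
  have hrm (t : ℕ) : Measurable fun ω => maxOver (fun z => f z ω) - f (x t ω) ω :=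
    hmax.sub (measurable_eval_choice (hxy t).1 hfm)
  have hfI (z : X) : Integrable (f z) P := (hf.isGaussianProcess.hasGaussianLaw_eval z).integrable
  have hrI (t : ℕ) : Integrable (fun ω => maxOver (fun z => f z ω) - f (x t ω) ω) P :=
    (Integrable.maxOver_comp hfI).sub (integrable_eval_choice (hxy t).1 hfm hfI)
  refine one_sub_le_measureReal_of_integral_le (Finset.measurable_fun_sum _ fun t _ => hrm t)
    (integrable_finsetSum _ fun t _ => hrI t) (fun ω => Finset.sum_nonneg fun t _ => hr0 t ω)
    (Real.sqrt_nonneg _) ?_ hδ0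
  rw [integral_finsetSum _ fun t _ => hrI t]
  -- With a single point the shift is negative and the domination argument is unavailable, but the
  -- regret is identically zero.
  rcases le_or_gt (Fintype.card X) 1 with hcard | hcard
  · have hsub : Subsingleton X := Fintype.card_le_one_iff_subsingleton.1 hcard
    rw [Finset.sum_eq_zero fun t _ => ?_]
    · exact Real.sqrt_nonneg _
    · refine integral_eq_zero_of_ae (Filter.Eventually.of_forall fun ω => ?_)
      change maxOver (fun z => f z ω) - f (x t ω) ω = 0
      rw [maxOver_eq (g := fun z => f z ω) (x := x t ω) fun z => by
        rw [Subsingleton.elim z (x t ω)], sub_self]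
  have hN (t : ℕ) : IsNoisyGP f (fun i : Fin t => ε i) k σ P :=
    IsNoisyGP.of_indepFun hfm (fun i => hεm i) hf (fun i => hε i)
      (hεi.precomp Fin.val_injective)
      (hind₁.comp (ψ := fun q : (ℕ → ℝ) × (ℕ → ℝ) × S => fun i : Fin t => q.1 i)
        measurable_id (by fun_prop))
  have hind : IndepFun (fun ω => (fun x => f x ω, fun t => ε t ω))
      (fun ω => (fun t => ζ t ω, ξ ω)) P := by
    have hεp : Measurable fun ω => fun t => ε t ω := measurable_pi_lambda _ hεm
    have hζp : Measurable fun ω => (fun t => ζ t ω, ξ ω) := (measurable_pi_lambda _ hζm).prodMk hξm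
    have h1 : IndepFun (fun ω => ((fun t => ζ t ω, ξ ω), fun t => ε t ω)) (fun ω x => f x ω) P :=
      hind₁.symm.comp measurable_swap measurable_id |>.congr
        (Filter.Eventually.of_forall fun ω => rfl) (ae_eq_refl _)
    have h2 := indepFun_prodMk_of_indepFun hζp hεp (measurable_pi_lambda _ hfm) hind₂.symm h1
    exact (h2.comp measurable_id measurable_swap).symm
  have hhalf : (0 : ℝ) < 1 / 2 := by norm_num
  have hs0 : 0 ≤ 2 * Real.log ((Fintype.card X : ℝ) / 2) := by
    have h2 : (2 : ℝ) ≤ Fintype.card X := by exact_mod_cast hcard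
    exact mul_nonneg zero_le_two (Real.log_nonneg (by linarith))
  have hζI (t : ℕ) : Integrable (ζ t) P := by
    have h1 := integrable_id_shiftedExpMeasure (2 * Real.log ((Fintype.card X : ℝ) / 2)) hhalf
    rw [← (hζ t).map_eq] at h1
    exact h1.comp_aemeasurable (hζ t).aemeasurable
  have hζ0 : ∀ᵐ ω ∂P, ∀ t, 0 ≤ ζ t ω := by
    refine ae_all_iff.2 fun t => ?_
    have h1 := ae_le_shiftedExpMeasure (2 * Real.log ((Fintype.card X : ℝ) / 2)) hhalf
    rw [← (hζ t).map_eq] at h1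
    filter_upwards [ae_of_ae_map (hζ t).aemeasurable h1] with ω hω
    exact hs0.trans hω
  -- The mean is the shift plus `1 / (1/2) = 2`, which is the origin of `C₂`.
  have hζE (t : ℕ) : ∫ ω, ζ t ω ∂P = C₂ := by
    rw [(hζ t).integral_eq, integral_id_shiftedExpMeasure _ hhalf]
    simp only [C₂]
    ring
  have hv0 (ω : Ω) (t : ℕ) : 0 ≤ queryVar k σ (fun i : Fin t => x i ω) (x t ω) :=
    (hN t).queryVar_nonneg hk hσ _ (e := id) Function.injective_id _
  have hsum (ω : Ω) : ∑ t ∈ Finset.range T, queryVar k σ (fun i : Fin t => x i ω) (x t ω)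
      ≤ C₁ * maxInfoGain k σ T := by
    rw [Finset.sum_range]
    exact sum_queryVar_le hk hk1 hσ (fun i : Fin T => x i ω) fun t => hv0 ω t
  have hZI : Integrable (fun ω => ∑ t ∈ Finset.range T, ζ t ω) P :=
    integrable_finsetSum _ fun t _ => hζI t
  have hxm (t : ℕ) : Measurable fun ω => fun i : Fin t => x i ω :=
    measurable_pi_lambda _ fun i => (hxy i).1
  have hG (t : ℕ) : Integrable
      (fun ω => √(ζ t ω) * √(queryVar k σ (fun i : Fin t => x i ω) (x t ω))) P :=
    integrable_eval_choice ((hxm t).prodMk (hxy t).1)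
      (g := fun (q : (Fin t → X) × X) ω => √(ζ t ω) * √(queryVar k σ q.1 q.2))
      (fun q => (Real.continuous_sqrt.measurable.comp (hζm t)).mul_const _)
      fun q => (integrable_sqrt (hζI t)).mul_const _
  have hC0 : 0 ≤ C₁ * maxInfoGain k σ T :=
    (Finset.sum_nonneg fun t _ => hv0 hΩ.some t).trans (hsum hΩ.some)
  calc ∑ t ∈ Finset.range T, ∫ ω, (maxOver (fun z => f z ω) - f (x t ω) ω) ∂P
      ≤ ∑ t ∈ Finset.range T,
          ∫ ω, √(ζ t ω) * √(queryVar k σ (fun i : Fin t => x i ω) (x t ω)) ∂P :=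
        Finset.sum_le_sum fun t _ => integral_regret_le hcard hk hσ hfm hεm hζm hξm hN hζ hζI hζi
          hind hind₃ hpick hx hy t
    _ = ∫ ω, ∑ t ∈ Finset.range T,
          √(ζ t ω) * √(queryVar k σ (fun i : Fin t => x i ω) (x t ω)) ∂P :=
        (integral_finsetSum _ fun t _ => hG t).symm
    _ ≤ ∫ ω, √(∑ t ∈ Finset.range T, ζ t ω) * √(C₁ * maxInfoGain k σ T) ∂P := by
        refine integral_mono_ae (integrable_finsetSum _ fun t _ => hG t)
          ((integrable_sqrt hZI).mul_const _) ?_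
        filter_upwards [hζ0] with ω hω
        -- Cauchy–Schwarz is applied before integrating, because the bound on the summed posterior
        -- variances holds along every path.
        refine (Real.sum_sqrt_mul_sqrt_le _ hω (hv0 ω)).trans ?_
        gcongr
        exact hsum ω
    _ ≤ √(∑ t ∈ Finset.range T, ∫ ω, ζ t ω ∂P) * √(C₁ * maxInfoGain k σ T) := by
        rw [integral_mul_const, ← integral_finsetSum _ fun t _ => hζI t]
        gcongr
        refine integral_sqrt_le hZI ?_
        filter_upwards [hζ0] with ω hω
        exact Finset.sum_nonneg fun t _ => hω t
    _ = √(C₁ * C₂ * T * maxInfoGain k σ T) := by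
        simp only [hζE, Finset.sum_const, Finset.card_range, nsmul_eq_mul]
        rw [← Real.sqrt_mul' _ hC0]
        congr 1
        ring
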